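/- Let $S_3$ be the symmetric group on three letters. Let $B:=B_{\mathbb Q}(S_3,S_3)$ be its double Burnside $\mathbb Q$-algebra: the $\mathbb Q$-vector space freely generated by the isomorphism classes of finite $(S_3,S_3)$-bisets modulo the relations $[M\sqcup N]=[M]+[N]$, with multiplication $[M][N]=[M\times_{S_3}N]$ and unit $[S_3]$. Let $L:=\mathbb Q[\eta,\xi]/(\eta^2,\eta\xi,\xi^2)$, with $\overline\eta,\overline\xi\in L$ the classes of $\eta,\xi$, and let $A=\bigoplus_{1\le i,j\le 4}A_{i,j}$ be the $\mathbb Q$-vector space of block matrices $$A=\begin{bmatrix}\mathbb Q^{3\times3}&0&0&\mathbb Q^{3\times1}\\0&\mathbb Q&0&\mathbb Q\\0&0&\mathbb Q&0\\\mathbb Q^{1\times3}&\mathbb Q&0&L\end{bmatrix}$$ with the block multiplication $(xy)_{i,j}=\sum_{r} x_{i,r}y_{r,j}$, where the products of blocks $A_{i,r}\times A_{r,j}\to A_{i,j}$ are as follows: the products $A_{1,4}\times A_{4,1}\to A_{1,1}$ and $A_{2,4}\times A_{4,2}\to A_{2,2}$ are zero, as is every product in which one of the three blocks $A_{i,r}$,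 $A_{r,j}$, $A_{i,j}$ is zero; $A_{4,1}\times A_{1,4}\to A_{4,4}$ is $(v,u)\mapsto (vu)\,\overline\eta$; $A_{4,2}\times A_{2,4}\to A_{4,4}$ is $(u,v)\mapsto uv(\overline\xi-12\overline\eta)$; an element $a+b\overline\eta+c\overline\xi$ of $A_{4,4}=L$ acts on $A_{1,4}$, $A_{2,4}$ from the right and on $A_{4,1}$, $A_{4,2}$ from the left as multiplication by $a$; all the other products are the usual products of matrices, scalars or elements of $L$. This is an associative unital $\mathbb Q$-algebra. For $(i,j)\in\{(1,1),(2,2),(3,3),(4,4),(1,4),(4,1),(2,4),(4,2)\}$ let $a_{i,j}\in A$ be the element whose only non-zero block is the one at position $(i,j)$, this block being $1$, except that for $(i,j)\in\{(1,1),(1,4),(4,1)\}$ it is the matrix with first entry (that is, the entry at position $(1,1)$ of the block) equal to $1$ and all other entries $0$. Let $a:=a_{1,1}+a_{2,2}+a_{3,3}+a_{4,4}$, which is an idempotent, and let $A':=aAa$ be the corresponding corner algebra, with unit $a$. Let $\Psi$ be the quiver with vertices $\tilde a_{1,1},\tilde a_{2,2},\tilde a_{3,3},\tilde a_{4,4}$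 and arrows $\rho:\tilde a_{4,4}\to\tilde a_{1,1}$, $\pi:\tilde a_{1,1}\to\tilde a_{4,4}$, $\vartheta:\tilde a_{4,4}\to\tilde a_{2,2}$, $\sigma:\tilde a_{2,2}\to\tilde a_{4,4}$ (so $\tilde a_{3,3}$ is isolated). Let $\mathbb Q\Psi$ be its path algebra, in which the product $pq$ of two paths means first $p$, then $q$, and in which a vertex stands for the trivial path at it. Let $I=(\pi\rho,\sigma\vartheta,\pi\vartheta,\sigma\rho)$ be the two-sided ideal generated by the four listed elements. Then there is an isomorphism of $\mathbb Q$-algebras $A'\xrightarrow{\sim}\mathbb Q\Psi/I$ with $$a_{i,i}\mapsto\tilde a_{i,i}+I\ (1\le i\le 4),\quad a_{4,1}\mapsto\rho+I,\quad a_{1,4}\mapsto\pi+I,\quad a_{4,2}\mapsto\vartheta+I,\quad a_{2,4}\mapsto\sigma+I.$$ Moreover $A\cong B$ as $\mathbb Q$-algebras, and $\mathbb Q\Psi/I$ is Morita equivalent over $\mathbb Q$ to $A$ and to $B=B_{\mathbb Q}(S_3,S_3)$. -/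

import Mathlib

universe u v w

/-! ## The double Burnside algebra of a finite group -/

section Burnside

/-- A finite `(G, G)`-biset: a finite set with a left `G`-action and a right `G`-action (that is,
an action of the opposite group) that commute with each other. -/
structure FinBiset (G : Type u) [Group G] where
  /-- The underlying set. -/
  carrier : Type u
  [finite : Finite carrier]
  [left : MulAction G carrier]
  [right : MulAction Gᵐᵒᵖ carrier]
  [comm : SMulCommClass G Gᵐᵒᵖ carrier]

namespace FinBiset

variable {G : Type u} [Group G]

instance : CoeSort (FinBiset G) (Type u) := ⟨FinBiset.carrier⟩

attribute [instance] FinBiset.finite FinBiset.left FinBiset.right FinBiset.comm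

/-- Two bisets are isomorphic if there is a bijection compatible with both actions. -/
def Iso (M N : FinBiset G) : Prop :=
  ∃ e : M ≃ N, (∀ (g : G) (x : M), e (g • x) = g • e x) ∧
    ∀ (g : Gᵐᵒᵖ) (x : M), e (g • x) = g • e x

theorem Iso.refl (M : FinBiset G) : Iso M M :=
  ⟨Equiv.refl _, fun _ _ => rfl, fun _ _ => rfl⟩

theorem Iso.symm {M N : FinBiset G} : Iso M N → Iso N M := by
  rintro ⟨e, hl, hr⟩
  refine ⟨e.symm, fun g x => ?_, fun g x => ?_⟩
  · apply e.injective
    rw [hl, e.apply_symm_apply, e.apply_symm_apply]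
  · apply e.injective
    rw [hr, e.apply_symm_apply, e.apply_symm_apply]

theorem Iso.trans {M N L : FinBiset G} : Iso M N → Iso N L → Iso M L := by
  rintro ⟨e, hl, hr⟩ ⟨f, kl, kr⟩
  exact ⟨e.trans f, fun g x => by simp [hl, kl], fun g x => by simp [hr, kr]⟩

instance isoSetoid (G : Type u) [Group G] : Setoid (FinBiset G) where
  r := Iso
  iseqv := ⟨Iso.refl, Iso.symm, Iso.trans⟩

/-- The regular biset `G`, with both actions given by multiplication. -/
def regular (G : Type u) [Group G] [Finite G] : FinBiset G where
  carrier := G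

/-- Disjoint union of bisets. -/
def disjUnion (M N : FinBiset G) : FinBiset G where
  carrier := M ⊕ N
  comm := ⟨by rintro g h (x | x) <;> simp [Sum.smul_inl, Sum.smul_inr, smul_comm]⟩

/-- The equivalence relation on `M × N` whose classes are the orbits of the left `G`-action
`g (m, n) = (m g⁻¹, g n)`. -/
def tensorSetoid (M N : FinBiset G) : Setoid (M × N) where
  r x y := ∃ g : G, (MulOpposite.op g⁻¹ • x.1, g • x.2) = y
  iseqv := by
    refine ⟨fun x => ⟨1, by simp⟩, ?_, ?_⟩
    · rintro ⟨m, n⟩ _ ⟨g, rfl⟩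
      exact ⟨g⁻¹, by simp [← mul_smul]⟩
    · rintro ⟨m, n⟩ _ _ ⟨g, rfl⟩ ⟨h, rfl⟩
      exact ⟨h * g, by simp [mul_smul]⟩

/-- The underlying set of the tensor product `M ×_G N`. -/
def TensorCarrier (M N : FinBiset G) : Type u := Quotient (tensorSetoid M N)

/-- The class of the pair `(m, n)` in `M ×_G N`. -/
def tmk {M N : FinBiset G} (m : M) (n : N) : TensorCarrier M N :=
  Quotient.mk (tensorSetoid M N) (m, n)

theorem tmk_surj {M N : FinBiset G} (x : TensorCarrier M N) : ∃ m n, tmk m n = x := by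
  induction x using Quotient.ind with
  | _ x => exact ⟨x.1, x.2, rfl⟩

theorem tmk_eq_iff {M N : FinBiset G} {m m' : M} {n n' : N} :
    tmk m n = tmk m' n' ↔ ∃ g : G, MulOpposite.op g⁻¹ • m = m' ∧ g • n = n' := by
  constructor
  · intro h
    obtain ⟨g, hg⟩ := Quotient.exact (s := tensorSetoid M N) h
    exact ⟨g, (Prod.mk.inj hg).1, (Prod.mk.inj hg).2⟩
  · rintro ⟨g, h1, h2⟩
    exact Quotient.sound (s := tensorSetoid M N) ⟨g, Prod.ext h1 h2⟩

theorem tmk_smul_smul {M N : FinBiset G} (g : G) (m : M) (n : N) :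
    tmk (MulOpposite.op g⁻¹ • m) (g • n) = tmk m n :=
  (tmk_eq_iff.2 ⟨g, rfl, rfl⟩).symm

/-- `(m g, n)` and `(m, g n)` have the same class. -/
theorem tmk_balance {M N : FinBiset G} (g : G) (m : M) (n : N) :
    tmk (MulOpposite.op g • m) n = tmk m (g • n) :=
  tmk_eq_iff.2 ⟨g, by simp [← mul_smul], rfl⟩

/-- Descent of a balanced map to the tensor product. -/
def tlift {M N : FinBiset G} {Z : Type v} (f : M → N → Z)
    (hf : ∀ (g : G) m n, f (MulOpposite.op g⁻¹ • m) (g • n) = f m n) : TensorCarrier M N → Z :=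
  Quotient.lift (fun x : M × N => f x.1 x.2) (by
    rintro ⟨m, n⟩ _ ⟨g, rfl⟩
    exact (hf g m n).symm)

/-- The left action on the tensor product: `h (m ×_G n) = (h m) ×_G n`. -/
instance tensorLeft (M N : FinBiset G) : MulAction G (TensorCarrier M N) where
  smul h := tlift (fun m n => tmk (h • m) n) (fun g m n =>
    tmk_eq_iff.2 ⟨g⁻¹, by simp [smul_comm h, ← mul_smul]⟩)
  one_smul x := by
    obtain ⟨m, n, rfl⟩ := tmk_surj x
    exact congrArg (fun a => tmk a n) (one_smul G m)
  mul_smul a b x := by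
    obtain ⟨m, n, rfl⟩ := tmk_surj x
    exact congrArg (fun c => tmk c n) (mul_smul a b m)

/-- The right action on the tensor product: `(m ×_G n) p = m ×_G (n p)`. -/
instance tensorRight (M N : FinBiset G) : MulAction Gᵐᵒᵖ (TensorCarrier M N) where
  smul p := tlift (fun m n => tmk m (p • n)) (fun g m n =>
    tmk_eq_iff.2 ⟨g⁻¹, by simp [← smul_comm _ p, ← mul_smul]⟩)
  one_smul x := by
    obtain ⟨m, n, rfl⟩ := tmk_surj x
    exact congrArg (fun a => tmk m a) (one_smul Gᵐᵒᵖ n)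
  mul_smul a b x := by
    obtain ⟨m, n, rfl⟩ := tmk_surj x
    exact congrArg (fun c => tmk m c) (mul_smul a b n)

theorem smul_tmk {M N : FinBiset G} (h : G) (m : M) (n : N) : h • tmk m n = tmk (h • m) n := rfl

theorem op_smul_tmk {M N : FinBiset G} (p : Gᵐᵒᵖ) (m : M) (n : N) :
    p • tmk m n = tmk m (p • n) := rfl

/-- The tensor product `M ×_G N` of two bisets. -/
def tensor (M N : FinBiset G) : FinBiset G where
  carrier := TensorCarrier M N
  finite := inferInstanceAs (Finite (Quotient (tensorSetoid M N)))
  comm := ⟨fun g p x => by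
    obtain ⟨m, n, rfl⟩ := tmk_surj x
    rfl⟩

/-- A map between tensor products and an inverse, both compatible with representatives, give
isomorphisms. This is the way in which all the isomorphisms below are built. -/
theorem Iso.of_maps {M N : FinBiset G} (f : M → N) (k : N → M) (h₁ : ∀ x, k (f x) = x)
    (h₂ : ∀ y, f (k y) = y) (hl : ∀ (g : G) (x : M), f (g • x) = g • f x)
    (hr : ∀ (g : Gᵐᵒᵖ) (x : M), f (g • x) = g • f x) : Iso M N :=
  ⟨⟨f, k, h₁, h₂⟩, hl, hr⟩

theorem tensor_congr {M M' N N' : FinBiset G} (h : Iso M M') (k : Iso N N') :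
    Iso (tensor M N) (tensor M' N') := by
  obtain ⟨e, el, er⟩ := h
  obtain ⟨f, fl, fr⟩ := k
  have el' : ∀ (g : G) x, e.symm (g • x) = g • e.symm x := fun g x => by
    apply e.injective; simp [el]
  have er' : ∀ (g : Gᵐᵒᵖ) x, e.symm (g • x) = g • e.symm x := fun g x => by
    apply e.injective; simp [er]
  have fl' : ∀ (g : G) x, f.symm (g • x) = g • f.symm x := fun g x => by
    apply f.injective; simp [fl]
  refine Iso.of_maps (M := tensor M N) (N := tensor M' N')
    (tlift (fun m n => tmk (e m) (f n)) fun g m n => ?_)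
    (tlift (fun m n => tmk (e.symm m) (f.symm n)) fun g m n => ?_) ?_ ?_ ?_ ?_
  · rw [er, fl]
    exact (tmk_eq_iff.2 ⟨g, rfl, rfl⟩).symm
  · rw [er', fl']
    exact (tmk_eq_iff.2 ⟨g, rfl, rfl⟩).symm
  · intro x
    obtain ⟨m, n, rfl⟩ := tmk_surj x
    change tmk (e.symm (e m)) (f.symm (f n)) = _
    simp
  · intro x
    obtain ⟨m, n, rfl⟩ := tmk_surj x
    change tmk (e (e.symm m)) (f (f.symm n)) = _
    simp
  · intro g x
    obtain ⟨m, n, rfl⟩ := tmk_surj x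
    exact congrArg (fun a => tmk a (f n)) (el g m)
  · intro g x
    obtain ⟨m, n, rfl⟩ := tmk_surj x
    exact congrArg (fun a => tmk (e m) a) (fr g n)

theorem disjUnion_congr {M M' N N' : FinBiset G} (h : Iso M M') (k : Iso N N') :
    Iso (disjUnion M N) (disjUnion M' N') := by
  obtain ⟨e, el, er⟩ := h
  obtain ⟨f, fl, fr⟩ := k
  refine ⟨Equiv.sumCongr e f, ?_, ?_⟩
  · rintro g (x | x)
    · exact congrArg Sum.inl (el g x)
    · exact congrArg Sum.inr (fl g x)
  · rintro g (x | x)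
    · exact congrArg Sum.inl (er g x)
    · exact congrArg Sum.inr (fr g x)

theorem regular_tensor [Finite G] (M : FinBiset G) : Iso (tensor (regular G) M) M := by
  have key : ∀ (h : G) (m : M), tmk (M := regular G) (1 : G) (h • m) =
      tmk (M := regular G) h m := fun h m =>
    (tmk_balance (M := regular G) h (1 : G) m).symm.trans
      (congrArg (fun a : G => tmk (M := regular G) a m) (one_mul h))
  have bal : ∀ (g h : G) (m : M), (h * g⁻¹) • g • m = h • m := fun g h m => by
    simp [← mul_smul]
  refine Iso.of_maps (M := tensor (regular G) M)
    (tlift (M := regular G) (fun (h : G) (m : M) => h • m) bal)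
    (fun m => tmk (M := regular G) (1 : G) m) ?_ ?_ ?_ ?_
  · intro x
    obtain ⟨h, m, rfl⟩ := tmk_surj x
    exact key h m
  · intro m
    exact one_smul G m
  · intro g x
    obtain ⟨h, m, rfl⟩ := tmk_surj x
    exact mul_smul g (id h : G) m
  · intro g x
    obtain ⟨h, m, rfl⟩ := tmk_surj x
    exact smul_comm (id h : G) g m

theorem tensor_regular [Finite G] (M : FinBiset G) : Iso (tensor M (regular G)) M := by
  have key : ∀ (m : M) (h : G), tmk (N := regular G) (MulOpposite.op h • m) (1 : G) =
      tmk (N := regular G) m h := fun m h =>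
    (tmk_balance (N := regular G) h m (1 : G)).trans
      (congrArg (fun a : G => tmk (N := regular G) m a) (mul_one h))
  have bal : ∀ (g : G) (m : M) (h : G),
      MulOpposite.op (g * h) • MulOpposite.op g⁻¹ • m = MulOpposite.op h • m := fun g m h => by
    simp [← mul_smul]
  refine Iso.of_maps (M := tensor M (regular G))
    (tlift (N := regular G) (fun (m : M) (h : G) => MulOpposite.op h • m) bal)
    (fun m => tmk (N := regular G) m (1 : G)) ?_ ?_ ?_ ?_
  · intro x
    obtain ⟨m, h, rfl⟩ := tmk_surj x
    exact key m h
  · intro m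
    exact one_smul Gᵐᵒᵖ m
  · intro g x
    obtain ⟨m, h, rfl⟩ := tmk_surj x
    exact (smul_comm g (MulOpposite.op (id h : G)) m).symm
  · intro g x
    obtain ⟨m, h, rfl⟩ := tmk_surj x
    exact mul_smul g (MulOpposite.op (id h : G)) m

theorem tensor_assoc (M N L : FinBiset G) :
    Iso (tensor (tensor M N) L) (tensor M (tensor N L)) := by
  refine Iso.of_maps (M := tensor (tensor M N) L) (N := tensor M (tensor N L))
    (tlift (fun (x : TensorCarrier M N) (l : L) =>
      tlift (fun m n => (tmk m (tmk n l : tensor N L) : TensorCarrier M (tensor N L)))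
        (fun g m n =>
          tmk_smul_smul (N := tensor N L) g m (tmk n l : tensor N L)) x) fun g x l => ?_)
    (tlift (fun (m : M) (y : TensorCarrier N L) =>
      tlift (fun n l => (tmk (tmk m n : tensor M N) l : TensorCarrier (tensor M N) L))
        (fun g n l => by
          rw [← tmk_smul_smul (M := tensor M N) g (tmk m n : tensor M N) l]; rfl) y)
      fun g m y => ?_) ?_ ?_ ?_ ?_
  · obtain ⟨m, n, rfl⟩ := tmk_surj x
    refine congrArg (fun z => (tmk m (z : tensor N L) : TensorCarrier M (tensor N L))) ?_
    exact (tmk_eq_iff.2 ⟨g, rfl, rfl⟩).symm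
  · obtain ⟨n, l, rfl⟩ := tmk_surj y
    refine congrArg (fun z => (tmk (z : tensor M N) l : TensorCarrier (tensor M N) L)) ?_
    exact (tmk_eq_iff.2 ⟨g, rfl, rfl⟩).symm
  · intro x
    obtain ⟨x, l, rfl⟩ := tmk_surj x
    obtain ⟨m, n, rfl⟩ := tmk_surj x
    rfl
  · intro x
    obtain ⟨m, x, rfl⟩ := tmk_surj x
    obtain ⟨n, l, rfl⟩ := tmk_surj x
    rfl
  · intro g x
    obtain ⟨x, l, rfl⟩ := tmk_surj x
    obtain ⟨m, n, rfl⟩ := tmk_surj x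
    rfl
  · intro g x
    obtain ⟨x, l, rfl⟩ := tmk_surj x
    obtain ⟨m, n, rfl⟩ := tmk_surj x
    rfl

theorem disjUnion_tensor (M N L : FinBiset G) :
    Iso (tensor (disjUnion M N) L) (disjUnion (tensor M L) (tensor N L)) := by
  refine Iso.of_maps (M := tensor (disjUnion M N) L) (N := disjUnion (tensor M L) (tensor N L))
    (tlift (fun (x : M ⊕ N) (l : L) =>
      (Sum.map (fun m => tmk m l) (fun n => tmk n l) x : TensorCarrier M L ⊕ TensorCarrier N L))
      fun g x l => ?_)
    (Sum.elim
      (tlift (fun (m : M) (l : L) => tmk (M := disjUnion M N) (Sum.inl m) l) fun g m l =>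
        tmk_smul_smul (M := disjUnion M N) g (Sum.inl m) l)
      (tlift (fun (n : N) (l : L) => tmk (M := disjUnion M N) (Sum.inr n) l) fun g n l =>
        tmk_smul_smul (M := disjUnion M N) g (Sum.inr n) l))
    ?_ ?_ ?_ ?_
  · obtain x | x := x
    · exact congrArg Sum.inl (tmk_eq_iff.2 ⟨g, rfl, rfl⟩).symm
    · exact congrArg Sum.inr (tmk_eq_iff.2 ⟨g, rfl, rfl⟩).symm
  · intro x
    obtain ⟨x | x, l, rfl⟩ := tmk_surj x <;> rfl
  · rintro (x | x) <;> obtain ⟨m, l, rfl⟩ := tmk_surj x <;> rfl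
  · intro g x
    obtain ⟨x | x, l, rfl⟩ := tmk_surj x <;> rfl
  · intro g x
    obtain ⟨x | x, l, rfl⟩ := tmk_surj x <;> rfl

theorem tensor_disjUnion (L M N : FinBiset G) :
    Iso (tensor L (disjUnion M N)) (disjUnion (tensor L M) (tensor L N)) := by
  refine Iso.of_maps (M := tensor L (disjUnion M N)) (N := disjUnion (tensor L M) (tensor L N))
    (tlift (fun (l : L) (x : M ⊕ N) =>
      (Sum.map (fun m => tmk l m) (fun n => tmk l n) x : TensorCarrier L M ⊕ TensorCarrier L N))
      fun g l x => ?_)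
    (Sum.elim
      (tlift (fun (l : L) (m : M) => tmk (N := disjUnion M N) l (Sum.inl m)) fun g l m =>
        tmk_smul_smul (N := disjUnion M N) g l (Sum.inl m))
      (tlift (fun (l : L) (n : N) => tmk (N := disjUnion M N) l (Sum.inr n)) fun g l n =>
        tmk_smul_smul (N := disjUnion M N) g l (Sum.inr n)))
    ?_ ?_ ?_ ?_
  · obtain x | x := x
    · exact congrArg Sum.inl (tmk_eq_iff.2 ⟨g, rfl, rfl⟩).symm
    · exact congrArg Sum.inr (tmk_eq_iff.2 ⟨g, rfl, rfl⟩).symm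
  · intro x
    obtain ⟨l, x | x, rfl⟩ := tmk_surj x <;> rfl
  · rintro (x | x) <;> obtain ⟨m, l, rfl⟩ := tmk_surj x <;> rfl
  · intro g x
    obtain ⟨l, x | x, rfl⟩ := tmk_surj x <;> rfl
  · intro g x
    obtain ⟨l, x | x, rfl⟩ := tmk_surj x <;> rfl

end FinBiset

/-- Isomorphism classes of finite `(G, G)`-bisets. -/
def BisetClass (G : Type u) [Group G] : Type (u + 1) := Quotient (FinBiset.isoSetoid G)

namespace BisetClass

variable {G : Type u} [Group G]

/-- The isomorphism class of a biset. -/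
def mk (M : FinBiset G) : BisetClass G := Quotient.mk _ M

/-- Addition of classes is induced by the disjoint union. -/
instance : Add (BisetClass G) where
  add := Quotient.map₂ FinBiset.disjUnion
    fun _ _ h _ _ k => FinBiset.disjUnion_congr h k

/-- Multiplication of classes is induced by the tensor product; the unit is the class of `G`. -/
instance [Finite G] : Monoid (BisetClass G) where
  mul := Quotient.map₂ FinBiset.tensor fun _ _ h _ _ k => FinBiset.tensor_congr h k
  one := mk (FinBiset.regular G)
  mul_assoc := by
    rintro ⟨M⟩ ⟨N⟩ ⟨L⟩
    exact Quotient.sound (FinBiset.tensor_assoc M N L)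
  one_mul := by
    rintro ⟨M⟩
    exact Quotient.sound (FinBiset.regular_tensor M)
  mul_one := by
    rintro ⟨M⟩
    exact Quotient.sound (FinBiset.tensor_regular M)

theorem mk_add_mk (M N : FinBiset G) : mk M + mk N = mk (M.disjUnion N) := rfl

theorem mk_mul_mk [Finite G] (M N : FinBiset G) : mk M * mk N = mk (M.tensor N) := rfl

theorem one_def [Finite G] : (1 : BisetClass G) = mk (FinBiset.regular G) := rfl

instance [Finite G] : Distrib (BisetClass G) where
  left_distrib := by
    rintro ⟨M⟩ ⟨N⟩ ⟨L⟩
    exact Quotient.sound (FinBiset.tensor_disjUnion M N L)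
  right_distrib := by
    rintro ⟨M⟩ ⟨N⟩ ⟨L⟩
    exact Quotient.sound (FinBiset.disjUnion_tensor M N L)

end BisetClass

variable (R : Type v) [CommRing R] (G : Type u) [Group G] [Finite G]

/-- The `R`-submodule spanned by the elements `[M ⊔ N] - [M] - [N]` inside the `R`-module freely
generated by the isomorphism classes of finite bisets. -/
noncomputable def burnsideRel : Submodule R (MonoidAlgebra R (BisetClass G)) :=
  Submodule.span R {x | ∃ M N : BisetClass G, x =
    MonoidAlgebra.of R _ (M + N) - MonoidAlgebra.of R _ M - MonoidAlgebra.of R _ N}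

theorem burnsideRel_mul_left (x y : MonoidAlgebra R (BisetClass G)) (hy : y ∈ burnsideRel R G) :
    x * y ∈ burnsideRel R G := by
  induction x using MonoidAlgebra.induction_on with
  | of L =>
    induction hy using Submodule.span_induction with
    | mem y h =>
      obtain ⟨M, N, rfl⟩ := h
      refine Submodule.subset_span ⟨L * M, L * N, ?_⟩
      rw [← mul_add, map_mul, map_mul, map_mul, mul_sub, mul_sub]
    | zero => simp
    | add y z _ _ h k => rw [mul_add]; exact Submodule.add_mem _ h k
    | smul r y _ h => rw [mul_smul_comm]; exact Submodule.smul_mem _ r h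
  | add x z h k => rw [add_mul]; exact Submodule.add_mem _ h k
  | smul r x h => rw [smul_mul_assoc]; exact Submodule.smul_mem _ r h

theorem burnsideRel_mul_right (x y : MonoidAlgebra R (BisetClass G)) (hx : x ∈ burnsideRel R G) :
    x * y ∈ burnsideRel R G := by
  induction y using MonoidAlgebra.induction_on with
  | of L =>
    induction hx using Submodule.span_induction with
    | mem y h =>
      obtain ⟨M, N, rfl⟩ := h
      refine Submodule.subset_span ⟨M * L, N * L, ?_⟩
      rw [← add_mul, map_mul, map_mul, map_mul, sub_mul, sub_mul]
    | zero => simp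
    | add y z _ _ h k => rw [add_mul]; exact Submodule.add_mem _ h k
    | smul r y _ h => rw [smul_mul_assoc]; exact Submodule.smul_mem _ r h
  | add x z h k => rw [mul_add]; exact Submodule.add_mem _ h k
  | smul r x h => rw [mul_smul_comm]; exact Submodule.smul_mem _ r h

/-- The submodule of relations is a two-sided ideal for the product induced by the tensor product
of bisets. -/
noncomputable def burnsideIdeal : TwoSidedIdeal (MonoidAlgebra R (BisetClass G)) :=
  .mk' (burnsideRel R G : Set (MonoidAlgebra R (BisetClass G)))
    (Submodule.zero_mem _) (Submodule.add_mem _) (Submodule.neg_mem _)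
    (fun {x y} hy => burnsideRel_mul_left R G x y hy)
    (fun {x y} hx => burnsideRel_mul_right R G x y hx)

/-- The double Burnside `R`-algebra `B_R(G, G)`: the `R`-module freely generated by the isomorphism
classes of finite `(G, G)`-bisets modulo the relations `[M ⊔ N] = [M] + [N]`, with multiplication
`[M] [N] = [M ×_G N]`. -/
abbrev DoubleBurnside : Type (max v (u + 1)) := (burnsideIdeal R G).ringCon.Quotient

end Burnside

/-! ## Path algebras -/

section PathAlgebra

/-- All paths of a quiver, including the trivial path at each vertex. -/
abbrev QuiverPath (V : Type u) [Quiver.{w} V] : Type (max u w) := Σ a b : V, Quiver.Path a b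

/-- The path algebra `R V` of a quiver `V` over `R`: the free `R`-module on all paths of `V`.
The product of two paths `p` and `q` is the path `p q` (first `p`, then `q`) if the target of `p` is
the source of `q`, and it is zero otherwise. -/
def PathAlgebra (R : Type v) (V : Type u) [CommRing R] [Quiver.{w} V] : Type (max v u w) :=
  QuiverPath V →₀ R

namespace PathAlgebra

variable (R : Type v) {V : Type u} [CommRing R] [Quiver.{w} V]

noncomputable instance : AddCommGroup (PathAlgebra R V) :=
  inferInstanceAs (AddCommGroup (QuiverPath V →₀ R))

noncomputable instance : Module R (PathAlgebra R V) :=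
  inferInstanceAs (Module R (QuiverPath V →₀ R))

/-- The basis element of the path algebra given by a path. -/
noncomputable def ofPath {a b : V} (p : Quiver.Path a b) : PathAlgebra R V :=
  Finsupp.single (⟨a, b, p⟩ : QuiverPath V) (1 : R)

/-- The basis element given by the trivial path at a vertex. -/
noncomputable def vertex (a : V) : PathAlgebra R V := ofPath R (Quiver.Path.nil : Quiver.Path a a)

/-- The basis element given by a path of length one. -/
noncomputable def arrow {a b : V} (f : a ⟶ b) : PathAlgebra R V := ofPath R f.toPath

open Classical in
/-- Product of two basis elements. -/
noncomputable def pathMul : QuiverPath V → QuiverPath V → PathAlgebra R V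
  | ⟨_, b, p⟩, ⟨c, _, q⟩ => if h : c = b then ofPath R (p.comp (q.cast h rfl)) else 0

/-- The multiplication, as the bilinear extension of the product of paths. -/
noncomputable def mulHom : PathAlgebra R V →ₗ[R] PathAlgebra R V →ₗ[R] PathAlgebra R V :=
  Finsupp.lift _ R (QuiverPath V) fun p => Finsupp.lift _ R (QuiverPath V) fun q => pathMul R p q

noncomputable instance : Mul (PathAlgebra R V) := ⟨fun x y => mulHom R x y⟩

variable {R}

theorem mul_def (x y : PathAlgebra R V) : x * y = mulHom R x y := rfl

theorem mulHom_ofPath {a b c d : V} (p : Quiver.Path a b) (q : Quiver.Path c d) :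
    ofPath R p * ofPath R q = pathMul R ⟨a, b, p⟩ ⟨c, d, q⟩ := by
  have h1 : mulHom R (ofPath R p) =
      Finsupp.lift (PathAlgebra R V) R (QuiverPath V) fun q => pathMul R ⟨a, b, p⟩ q :=
    (Finsupp.lift_apply _ _ _ _ _).trans
      ((Finsupp.sum_single_index (h := fun p r => r • Finsupp.lift (PathAlgebra R V) R
        (QuiverPath V) fun q => pathMul R p q) (zero_smul R _)).trans (one_smul R _))
  rw [mul_def, h1]
  exact (Finsupp.lift_apply _ _ _ _ _).trans
    ((Finsupp.sum_single_index (h := fun q r => r • pathMul R ⟨a, b, p⟩ q)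
      (zero_smul R _)).trans (one_smul R _))

theorem ofPath_mul_ofPath {a b c : V} (p : Quiver.Path a b) (q : Quiver.Path b c) :
    ofPath R p * ofPath R q = ofPath R (p.comp q) := by
  rw [mulHom_ofPath]
  simp [pathMul]

theorem ofPath_mul_ofPath_of_ne {a b c d : V} (p : Quiver.Path a b) (q : Quiver.Path c d)
    (h : b ≠ c) : ofPath R p * ofPath R q = 0 := by
  rw [mulHom_ofPath]
  simp [pathMul, h.symm]

@[elab_as_elim]
theorem induction_path {P : PathAlgebra R V → Prop} (x : PathAlgebra R V) (zero : P 0)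
    (add : ∀ x y, P x → P y → P (x + y)) (path : ∀ (r : R) {a b : V} (p : Quiver.Path a b),
      P (r • ofPath R p)) : P x := by
  refine Finsupp.induction_linear x zero (fun x y => add x y) ?_
  rintro ⟨a, b, p⟩ r
  have h : (r • ofPath R p : PathAlgebra R V) = Finsupp.single (⟨a, b, p⟩ : QuiverPath V) r :=
    (Finsupp.smul_single r _ (1 : R)).trans (congrArg _ (mul_one r))
  exact h ▸ path r p

noncomputable instance [Fintype V] : One (PathAlgebra R V) := ⟨∑ a : V, vertex R a⟩

theorem one_def [Fintype V] : (1 : PathAlgebra R V) = ∑ a : V, vertex R a := rfl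

theorem smul_mul (r : R) (x y : PathAlgebra R V) : (r • x) * y = r • (x * y) := by
  simp [mul_def]

theorem mul_smul' (r : R) (x y : PathAlgebra R V) : x * (r • y) = r • (x * y) := by
  simp [mul_def]

theorem add_mul' (x y z : PathAlgebra R V) : (x + y) * z = x * z + y * z := by
  simp [mul_def]

theorem mul_add' (x y z : PathAlgebra R V) : x * (y + z) = x * y + x * z := by
  simp [mul_def]

theorem zero_mul' (x : PathAlgebra R V) : 0 * x = 0 := by simp [mul_def]

theorem mul_zero' (x : PathAlgebra R V) : x * 0 = 0 := by simp [mul_def]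

theorem mul_assoc' (x y z : PathAlgebra R V) : x * y * z = x * (y * z) := by
  induction x using induction_path with
  | zero => simp only [zero_mul']
  | add x x' h h' => simp only [add_mul', h, h']
  | path r p =>
    induction y using induction_path with
    | zero => simp only [zero_mul', mul_zero']
    | add y y' h h' => simp only [add_mul', mul_add', h, h']
    | path s q =>
      induction z using induction_path with
      | zero => simp only [mul_zero']
      | add z z' h h' => simp only [mul_add', h, h']
      | path t l =>
        rename_i a b c d e f
        simp only [smul_mul, mul_smul']
        by_cases h : b = c
        · subst h
          by_cases k : d = e
          · subst k
            simp only [ofPath_mul_ofPath, Quiver.Path.comp_assoc]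
          · rw [ofPath_mul_ofPath_of_ne q l k, ofPath_mul_ofPath,
              ofPath_mul_ofPath_of_ne _ l k, mul_zero']
        · by_cases k : d = e
          · subst k
            rw [ofPath_mul_ofPath_of_ne p q h, ofPath_mul_ofPath,
              ofPath_mul_ofPath_of_ne p _ h, zero_mul']
          · rw [ofPath_mul_ofPath_of_ne p q h, ofPath_mul_ofPath_of_ne q l k, zero_mul',
              mul_zero']

theorem sum_mul' {ι : Type*} (s : Finset ι) (f : ι → PathAlgebra R V) (x : PathAlgebra R V) :
    (∑ i ∈ s, f i) * x = ∑ i ∈ s, f i * x := by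
  simp [mul_def]

theorem mul_sum' {ι : Type*} (s : Finset ι) (f : ι → PathAlgebra R V) (x : PathAlgebra R V) :
    x * (∑ i ∈ s, f i) = ∑ i ∈ s, x * f i := by
  simp [mul_def]

theorem one_mul' [Fintype V] (x : PathAlgebra R V) : 1 * x = x := by
  induction x using induction_path with
  | zero => exact mul_zero' _
  | add x y h k => rw [mul_add', h, k]
  | path r p =>
    rename_i a b
    rw [mul_smul', one_def, sum_mul', Finset.sum_eq_single a]
    · rw [vertex, ofPath_mul_ofPath, Quiver.Path.nil_comp]
    · exact fun c _ hc => ofPath_mul_ofPath_of_ne _ _ hc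
    · simp

theorem mul_one' [Fintype V] (x : PathAlgebra R V) : x * 1 = x := by
  induction x using induction_path with
  | zero => exact zero_mul' _
  | add x y h k => rw [add_mul', h, k]
  | path r p =>
    rename_i a b
    rw [smul_mul, one_def, mul_sum', Finset.sum_eq_single b]
    · rw [vertex, ofPath_mul_ofPath, Quiver.Path.comp_nil]
    · exact fun c _ hc => ofPath_mul_ofPath_of_ne _ _ hc.symm
    · simp

noncomputable instance [Fintype V] : Ring (PathAlgebra R V) where
  __ := (inferInstance : AddCommGroup (PathAlgebra R V))
  mul_assoc := mul_assoc'
  one_mul := one_mul'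
  mul_one := mul_one'
  left_distrib := mul_add'
  right_distrib := add_mul'
  zero_mul := zero_mul'
  mul_zero := mul_zero'

noncomputable instance [Fintype V] : Algebra R (PathAlgebra R V) :=
  Algebra.ofModule smul_mul mul_smul'

end PathAlgebra

end PathAlgebra

/-! ## Corner algebras -/

section Corner

variable {R : Type u} [CommRing R] {S : Type v} [Ring S] [Algebra R S] {e : S}

/-- The corner `e S e` of an `R`-algebra `S` inherits the scalar multiplication of `S`. -/
instance cornerSMul (he : IsIdempotentElem e) : SMul R he.Corner where
  smul r x := ⟨r • x.1, by
    obtain ⟨y, hy⟩ := x.2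
    exact ⟨r • y, by simp [← hy]⟩⟩

theorem corner_coe_smul (he : IsIdempotentElem e) (r : R) (x : he.Corner) :
    (r • x).1 = r • x.1 := rfl

instance cornerModule (he : IsIdempotentElem e) : Module R he.Corner where
  one_smul x := Subtype.ext (one_smul R x.1)
  mul_smul r s x := Subtype.ext (mul_smul r s x.1)
  smul_zero r := Subtype.ext (smul_zero r)
  smul_add r x y := Subtype.ext (smul_add r x.1 y.1)
  add_smul r s x := Subtype.ext (add_smul r s x.1)
  zero_smul x := Subtype.ext (zero_smul R x.1)

/-- The corner `e S e` of an `R`-algebra `S` is an `R`-algebra with unit `e`. -/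
instance cornerAlgebra (he : IsIdempotentElem e) : Algebra R he.Corner :=
  Algebra.ofModule (fun r x y => Subtype.ext (smul_mul_assoc r x.1 y.1))
    (fun r x y => Subtype.ext (mul_smul_comm r x.1 y.1))

end Corner

/-! ## The algebra `A` and its corner `A'` -/

section AlgA

/-- The ideal `(η², η ξ, ξ²)` of `ℚ[η, ξ]`, where `η` and `ξ` are the variables `X 0` and `X 1`. -/
noncomputable def localIdeal : Ideal (MvPolynomial (Fin 2) ℚ) :=
  Ideal.span {MvPolynomial.X 0 ^ 2, MvPolynomial.X 0 * MvPolynomial.X 1, MvPolynomial.X 1 ^ 2}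

/-- The local algebra `ℚ[η, ξ] / (η², η ξ, ξ²)`. -/
def LocalAlg : Type := MvPolynomial (Fin 2) ℚ ⧸ localIdeal

noncomputable instance : CommRing LocalAlg :=
  inferInstanceAs (CommRing (MvPolynomial (Fin 2) ℚ ⧸ localIdeal))

noncomputable instance : Algebra ℚ LocalAlg :=
  inferInstanceAs (Algebra ℚ (MvPolynomial (Fin 2) ℚ ⧸ localIdeal))

/-- The quotient map `ℚ[η, ξ] → ℚ[η, ξ] / (η², η ξ, ξ²)`. -/
noncomputable def localMk : MvPolynomial (Fin 2) ℚ →ₐ[ℚ] LocalAlg :=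
  Ideal.Quotient.mkₐ ℚ localIdeal

theorem localMk_surjective : Function.Surjective localMk := Ideal.Quotient.mk_surjective

theorem localMk_eq_zero {p : MvPolynomial (Fin 2) ℚ} (h : p ∈ localIdeal) : localMk p = 0 :=
  Ideal.Quotient.eq_zero_iff_mem.2 h

/-- The class of `η`. -/
noncomputable def etaBar : LocalAlg := localMk (MvPolynomial.X 0)

/-- The class of `ξ`. -/
noncomputable def xiBar : LocalAlg := localMk (MvPolynomial.X 1)

/-- The map `a + b η + c ξ ↦ a`. -/
noncomputable def localAug : LocalAlg →ₐ[ℚ] ℚ :=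
  Ideal.Quotient.liftₐ localIdeal (MvPolynomial.aeval fun _ => (0 : ℚ)) (by
    intro a ha
    have : localIdeal ≤ RingHom.ker (MvPolynomial.aeval fun _ : Fin 2 => (0 : ℚ)) := by
      unfold localIdeal
      rw [Ideal.span_le]
      rintro x (rfl | rfl | rfl) <;> simp [RingHom.mem_ker]
    exact this ha)

theorem localAug_localMk (p : MvPolynomial (Fin 2) ℚ) :
    localAug (localMk p) = MvPolynomial.aeval (fun _ => (0 : ℚ)) p := rfl

theorem localAug_eta : localAug etaBar = 0 := by
  simp [etaBar, localAug_localMk]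

theorem localAug_xi : localAug xiBar = 0 := by
  simp [xiBar, localAug_localMk]

theorem eta_mul_eta : etaBar * etaBar = 0 := by
  unfold etaBar
  rw [← map_mul, ← pow_two]
  exact localMk_eq_zero (Ideal.subset_span (by simp))

theorem eta_mul_xi : etaBar * xiBar = 0 := by
  unfold etaBar xiBar
  rw [← map_mul]
  exact localMk_eq_zero (Ideal.subset_span (by simp))

theorem xi_mul_eta : xiBar * etaBar = 0 := by
  rw [mul_comm, eta_mul_xi]

theorem xi_mul_xi : xiBar * xiBar = 0 := by
  unfold xiBar
  rw [← map_mul, ← pow_two]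
  exact localMk_eq_zero (Ideal.subset_span (by simp))

/-- Every element is of the form `a + b η + c ξ`. -/
theorem local_exists_form (x : LocalAlg) :
    ∃ a b c : ℚ, x = algebraMap ℚ LocalAlg a + b • etaBar + c • xiBar := by
  obtain ⟨p, rfl⟩ := localMk_surjective x
  induction p using MvPolynomial.induction_on with
  | C a => exact ⟨a, 0, 0, by simp⟩
  | add p q hp hq =>
    obtain ⟨a, b, c, h⟩ := hp
    obtain ⟨a', b', c', h'⟩ := hq
    refine ⟨a + a', b + b', c + c', ?_⟩
    rw [map_add, h, h', map_add, add_smul, add_smul]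
    abel
  | mul_X p i hp =>
    obtain ⟨a, b, c, h⟩ := hp
    rw [map_mul, h]
    fin_cases i
    · refine ⟨0, a, 0, ?_⟩
      change _ * etaBar = _
      simp [add_mul, mul_assoc, eta_mul_eta, xi_mul_eta, Algebra.smul_def]
    · refine ⟨0, 0, a, ?_⟩
      change _ * xiBar = _
      simp [add_mul, mul_assoc, xi_mul_xi, eta_mul_xi, Algebra.smul_def]

theorem local_mul_eta (x : LocalAlg) : x * etaBar = localAug x • etaBar := by
  obtain ⟨a, b, c, rfl⟩ := local_exists_form x
  simp [add_mul, mul_assoc, eta_mul_eta, xi_mul_eta, localAug_eta, localAug_xi,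
    Algebra.smul_def]

theorem local_mul_xi (x : LocalAlg) : x * xiBar = localAug x • xiBar := by
  obtain ⟨a, b, c, rfl⟩ := local_exists_form x
  simp [add_mul, mul_assoc, xi_mul_xi, eta_mul_xi, localAug_eta, localAug_xi, Algebra.smul_def]

/-- The `ℚ`-vector space `A = ⨁ A i j` for `i, j ∈ {1, 2, 3, 4}`, whose elements are the block
matrices
```
[ x11   0    0   x14 ]
[  0   x22   0   x24 ]
[  0    0   x33   0  ]
[ x41  x42   0   x44 ]
```
with `x11 ∈ ℚ^(3×3)`, `x14 ∈ ℚ^(3×1)`, `x41 ∈ ℚ^(1×3)`, `x44 ∈ ℚ[η, ξ] / (η², η ξ, ξ²)` and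
with all other entries rational. -/
@[ext]
structure AlgA where
  x11 : Matrix (Fin 3) (Fin 3) ℚ
  x14 : Matrix (Fin 3) (Fin 1) ℚ
  x22 : ℚ
  x24 : ℚ
  x33 : ℚ
  x41 : Matrix (Fin 1) (Fin 3) ℚ
  x42 : ℚ
  x44 : LocalAlg

namespace AlgA

noncomputable instance : Zero AlgA := ⟨⟨0, 0, 0, 0, 0, 0, 0, 0⟩⟩

noncomputable instance : One AlgA := ⟨⟨1, 0, 1, 0, 1, 0, 0, 1⟩⟩

noncomputable instance : Add AlgA :=
  ⟨fun x y => ⟨x.x11 + y.x11, x.x14 + y.x14, x.x22 + y.x22, x.x24 + y.x24, x.x33 + y.x33,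
    x.x41 + y.x41, x.x42 + y.x42, x.x44 + y.x44⟩⟩

noncomputable instance : Neg AlgA :=
  ⟨fun x => ⟨-x.x11, -x.x14, -x.x22, -x.x24, -x.x33, -x.x41, -x.x42, -x.x44⟩⟩

noncomputable instance : SMul ℚ AlgA :=
  ⟨fun r x => ⟨r • x.x11, r • x.x14, r • x.x22, r • x.x24, r • x.x33, r • x.x41, r • x.x42,
    r • x.x44⟩⟩

/-- Block matrix multiplication, where the products of blocks are as follows. The product
`A 4 1 × A 1 4 → A 4 4` is `(v, u) ↦ (v u) η`, the product `A 4 2 × A 2 4 → A 4 4` is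
`(u, v) ↦ u v (ξ - 12 η)`, the products `A 1 4 × A 4 1 → A 1 1` and `A 2 4 × A 4 2 → A 2 2` are
zero, an element `a + b η + c ξ` of `A 4 4` acts on `A 1 4`, `A 2 4`, `A 4 1` and `A 4 2` as `a`,
and all other products are the evident ones. -/
noncomputable instance : Mul AlgA :=
  ⟨fun x y =>
    { x11 := x.x11 * y.x11
      x14 := x.x11 * y.x14 + localAug y.x44 • x.x14
      x22 := x.x22 * y.x22
      x24 := x.x22 * y.x24 + x.x24 * localAug y.x44
      x33 := x.x33 * y.x33
      x41 := x.x41 * y.x11 + localAug x.x44 • y.x41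
      x42 := x.x42 * y.x22 + localAug x.x44 * y.x42
      x44 := (x.x41 * y.x14) 0 0 • etaBar + (x.x42 * y.x24) • (xiBar - (12 : ℚ) • etaBar)
        + x.x44 * y.x44 }⟩

section lemmas

variable (x y : AlgA) (r : ℚ)

@[simp] theorem zero_x11 : (0 : AlgA).x11 = 0 := rfl
@[simp] theorem zero_x14 : (0 : AlgA).x14 = 0 := rfl
@[simp] theorem zero_x22 : (0 : AlgA).x22 = 0 := rfl
@[simp] theorem zero_x24 : (0 : AlgA).x24 = 0 := rfl
@[simp] theorem zero_x33 : (0 : AlgA).x33 = 0 := rfl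
@[simp] theorem zero_x41 : (0 : AlgA).x41 = 0 := rfl
@[simp] theorem zero_x42 : (0 : AlgA).x42 = 0 := rfl
@[simp] theorem zero_x44 : (0 : AlgA).x44 = 0 := rfl
@[simp] theorem one_x11 : (1 : AlgA).x11 = 1 := rfl
@[simp] theorem one_x14 : (1 : AlgA).x14 = 0 := rfl
@[simp] theorem one_x22 : (1 : AlgA).x22 = 1 := rfl
@[simp] theorem one_x24 : (1 : AlgA).x24 = 0 := rfl
@[simp] theorem one_x33 : (1 : AlgA).x33 = 1 := rfl
@[simp] theorem one_x41 : (1 : AlgA).x41 = 0 := rfl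
@[simp] theorem one_x42 : (1 : AlgA).x42 = 0 := rfl
@[simp] theorem one_x44 : (1 : AlgA).x44 = 1 := rfl
@[simp] theorem add_x11 : (x + y).x11 = x.x11 + y.x11 := rfl
@[simp] theorem add_x14 : (x + y).x14 = x.x14 + y.x14 := rfl
@[simp] theorem add_x22 : (x + y).x22 = x.x22 + y.x22 := rfl
@[simp] theorem add_x24 : (x + y).x24 = x.x24 + y.x24 := rfl
@[simp] theorem add_x33 : (x + y).x33 = x.x33 + y.x33 := rfl
@[simp] theorem add_x41 : (x + y).x41 = x.x41 + y.x41 := rfl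
@[simp] theorem add_x42 : (x + y).x42 = x.x42 + y.x42 := rfl
@[simp] theorem add_x44 : (x + y).x44 = x.x44 + y.x44 := rfl
@[simp] theorem neg_x11 : (-x).x11 = -x.x11 := rfl
@[simp] theorem neg_x14 : (-x).x14 = -x.x14 := rfl
@[simp] theorem neg_x22 : (-x).x22 = -x.x22 := rfl
@[simp] theorem neg_x24 : (-x).x24 = -x.x24 := rfl
@[simp] theorem neg_x33 : (-x).x33 = -x.x33 := rfl
@[simp] theorem neg_x41 : (-x).x41 = -x.x41 := rfl
@[simp] theorem neg_x42 : (-x).x42 = -x.x42 := rfl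
@[simp] theorem neg_x44 : (-x).x44 = -x.x44 := rfl
@[simp] theorem smul_x11 : (r • x).x11 = r • x.x11 := rfl
@[simp] theorem smul_x14 : (r • x).x14 = r • x.x14 := rfl
@[simp] theorem smul_x22 : (r • x).x22 = r • x.x22 := rfl
@[simp] theorem smul_x24 : (r • x).x24 = r • x.x24 := rfl
@[simp] theorem smul_x33 : (r • x).x33 = r • x.x33 := rfl
@[simp] theorem smul_x41 : (r • x).x41 = r • x.x41 := rfl
@[simp] theorem smul_x42 : (r • x).x42 = r • x.x42 := rfl
@[simp] theorem smul_x44 : (r • x).x44 = r • x.x44 := rfl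
@[simp] theorem mul_x11 : (x * y).x11 = x.x11 * y.x11 := rfl
@[simp] theorem mul_x14 : (x * y).x14 = x.x11 * y.x14 + localAug y.x44 • x.x14 := rfl
@[simp] theorem mul_x22 : (x * y).x22 = x.x22 * y.x22 := rfl
@[simp] theorem mul_x24 : (x * y).x24 = x.x22 * y.x24 + x.x24 * localAug y.x44 := rfl
@[simp] theorem mul_x33 : (x * y).x33 = x.x33 * y.x33 := rfl
@[simp] theorem mul_x41 : (x * y).x41 = x.x41 * y.x11 + localAug x.x44 • y.x41 := rfl
@[simp] theorem mul_x42 : (x * y).x42 = x.x42 * y.x22 + localAug x.x44 * y.x42 := rfl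
@[simp] theorem mul_x44 : (x * y).x44 = (x.x41 * y.x14) 0 0 • etaBar
    + (x.x42 * y.x24) • (xiBar - (12 : ℚ) • etaBar) + x.x44 * y.x44 := rfl

end lemmas

noncomputable instance : AddCommGroup AlgA where
  add_assoc x y z := by ext1 <;> simp [add_assoc]
  zero_add x := by ext1 <;> simp
  add_zero x := by ext1 <;> simp
  neg_add_cancel x := by ext1 <;> simp
  add_comm x y := by ext1 <;> simp [add_comm]
  nsmul := nsmulRec
  zsmul := zsmulRec

noncomputable instance : Module ℚ AlgA where
  one_smul x := by ext1 <;> simp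
  mul_smul r s x := by ext1 <;> simp [mul_smul, mul_assoc]
  smul_zero r := by ext1 <;> simp
  smul_add r x y := by ext1 <;> simp [mul_add]
  add_smul r s x := by ext1 <;> simp [add_smul, add_mul]
  zero_smul x := by ext1 <;> simp

theorem assoc_x44 (x y z : AlgA) : (x * y * z).x44 = (x * (y * z)).x44 := by
  have e1 : ∀ a : LocalAlg, etaBar * a = localAug a • etaBar := fun a => by
    rw [mul_comm, local_mul_eta]
  have e2 : ∀ a : LocalAlg, xiBar * a = localAug a • xiBar := fun a => by
    rw [mul_comm, local_mul_xi]
  simp only [mul_x44, mul_x41, mul_x42, mul_x14, mul_x24, add_mul, mul_add, sub_mul, mul_sub,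
    smul_mul_assoc, mul_smul_comm, e1, e2, local_mul_eta, local_mul_xi, Matrix.add_apply,
    Matrix.add_mul, Matrix.mul_add, Matrix.smul_mul, Matrix.mul_smul, Matrix.smul_apply,
    Matrix.mul_assoc, mul_assoc, smul_eq_mul]
  module

noncomputable instance : Ring AlgA where
  __ := (inferInstance : AddCommGroup AlgA)
  mul_assoc x y z := by
    ext1
    case x44 => exact assoc_x44 x y z
    all_goals
      simp only [mul_x11, mul_x14, mul_x22, mul_x24, mul_x33, mul_x41, mul_x42, mul_x44, map_add,
        map_mul, map_smul, map_sub, localAug_eta, localAug_xi, Matrix.mul_assoc,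
        Matrix.add_mul, Matrix.mul_add, Matrix.smul_mul, Matrix.mul_smul, smul_add, mul_smul, smul_zero, sub_zero, zero_add]
    all_goals first | ring | module
  one_mul x := by ext1 <;> simp
  mul_one x := by ext1 <;> simp
  left_distrib x y z := by
    ext1 <;> simp [mul_add, Matrix.mul_add, add_smul]
    all_goals first | ring | module
  right_distrib x y z := by
    ext1 <;> simp [add_mul, Matrix.add_mul, add_smul]
    all_goals first | ring | module
  zero_mul x := by ext1 <;> simp
  mul_zero x := by ext1 <;> simp

noncomputable instance : Algebra ℚ AlgA :=
  Algebra.ofModule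
    (fun r x y => by
      ext1 <;> simp [smul_add, mul_smul, mul_assoc, mul_add, smul_comm r])
    (fun r x y => by
      ext1 <;> simp [smul_add, mul_smul, mul_add, mul_left_comm _ r]
      exact smul_comm _ _ _)

/-- The element with entry `1` at position `(1, 1)` of the block `A 1 1`. -/
noncomputable def a11 : AlgA := { (0 : AlgA) with x11 := Matrix.single 0 0 1 }

/-- The element with entry `1` in `A 2 2`. -/
noncomputable def a22 : AlgA := { (0 : AlgA) with x22 := 1 }

/-- The element with entry `1` in `A 3 3`. -/
noncomputable def a33 : AlgA := { (0 : AlgA) with x33 := 1 }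

/-- The element with entry `1` in `A 4 4`. -/
noncomputable def a44 : AlgA := { (0 : AlgA) with x44 := 1 }

/-- The element with entry `1` at the first position of the block `A 1 4`. -/
noncomputable def a14 : AlgA := { (0 : AlgA) with x14 := Matrix.single 0 0 1 }

/-- The element with entry `1` at the first position of the block `A 4 1`. -/
noncomputable def a41 : AlgA := { (0 : AlgA) with x41 := Matrix.single 0 0 1 }

/-- The element with entry `1` in `A 2 4`. -/
noncomputable def a24 : AlgA := { (0 : AlgA) with x24 := 1 }

/-- The element with entry `1` in `A 4 2`. -/
noncomputable def a42 : AlgA := { (0 : AlgA) with x42 := 1 }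

/-- The idempotent that cuts out the corner. -/
noncomputable def cornerIdem : AlgA := a11 + a22 + a33 + a44

theorem cornerIdem_isIdempotentElem : IsIdempotentElem cornerIdem := by
  unfold IsIdempotentElem
  ext1 <;> simp [cornerIdem, a11, a22, a33, a44]

end AlgA

/-- The corner `A' = a A a` of `A` for `a = a11 + a22 + a33 + a44`, with unit `a`. -/
abbrev CornerA : Type := AlgA.cornerIdem_isIdempotentElem.Corner

namespace CornerA

theorem mem_aux {x : AlgA} (h : AlgA.cornerIdem * x * AlgA.cornerIdem = x) :
    x ∈ Subsemigroup.corner AlgA.cornerIdem := ⟨x, h⟩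

/-- `a11` as an element of the corner. -/
noncomputable def a11 : CornerA := ⟨AlgA.a11, mem_aux (by
  ext1 <;> simp [AlgA.cornerIdem, AlgA.a11, AlgA.a22, AlgA.a33, AlgA.a44])⟩

/-- `a22` as an element of the corner. -/
noncomputable def a22 : CornerA := ⟨AlgA.a22, mem_aux (by
  ext1 <;> simp [AlgA.cornerIdem, AlgA.a11, AlgA.a22, AlgA.a33, AlgA.a44])⟩

/-- `a33` as an element of the corner. -/
noncomputable def a33 : CornerA := ⟨AlgA.a33, mem_aux (by
  ext1 <;> simp [AlgA.cornerIdem, AlgA.a11, AlgA.a22, AlgA.a33, AlgA.a44])⟩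

/-- `a44` as an element of the corner. -/
noncomputable def a44 : CornerA := ⟨AlgA.a44, mem_aux (by
  ext1 <;> simp [AlgA.cornerIdem, AlgA.a11, AlgA.a22, AlgA.a33, AlgA.a44])⟩

/-- `a14` as an element of the corner. -/
noncomputable def a14 : CornerA := ⟨AlgA.a14, mem_aux (by
  ext1 <;> simp [AlgA.cornerIdem, AlgA.a11, AlgA.a22, AlgA.a33, AlgA.a44, AlgA.a14])⟩

/-- `a41` as an element of the corner. -/
noncomputable def a41 : CornerA := ⟨AlgA.a41, mem_aux (by
  ext1 <;> simp [AlgA.cornerIdem, AlgA.a11, AlgA.a22, AlgA.a33, AlgA.a44, AlgA.a41])⟩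

/-- `a24` as an element of the corner. -/
noncomputable def a24 : CornerA := ⟨AlgA.a24, mem_aux (by
  ext1 <;> simp [AlgA.cornerIdem, AlgA.a11, AlgA.a22, AlgA.a33, AlgA.a44, AlgA.a24])⟩

/-- `a42` as an element of the corner. -/
noncomputable def a42 : CornerA := ⟨AlgA.a42, mem_aux (by
  ext1 <;> simp [AlgA.cornerIdem, AlgA.a11, AlgA.a22, AlgA.a33, AlgA.a44, AlgA.a42])⟩

end CornerA

end AlgA

/-! ## The quiver `Ψ` and the ideal of relations -/

section Psi

/-- The vertices `1, 2, 3, 4` of the quiver `Ψ`. -/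
inductive Psi : Type
  | v1 | v2 | v3 | v4
  deriving DecidableEq

instance : Fintype Psi where
  elems := {.v1, .v2, .v3, .v4}
  complete x := by cases x <;> simp

/-- The arrows of the quiver `Ψ`: `ρ : 4 → 1`, `π : 1 → 4`, `ϑ : 4 → 2`, `σ : 2 → 4`. -/
inductive PsiArrow : Psi → Psi → Type
  | rho : PsiArrow .v4 .v1
  | pi : PsiArrow .v1 .v4
  | theta : PsiArrow .v4 .v2
  | sigma : PsiArrow .v2 .v4

instance : Quiver Psi := ⟨PsiArrow⟩

namespace Psi

/-- The arrow `ρ` in the path algebra. -/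
noncomputable def rho : PathAlgebra ℚ Psi :=
  PathAlgebra.arrow ℚ (show Psi.v4 ⟶ Psi.v1 from PsiArrow.rho)

/-- The arrow `π` in the path algebra. -/
noncomputable def pi : PathAlgebra ℚ Psi :=
  PathAlgebra.arrow ℚ (show Psi.v1 ⟶ Psi.v4 from PsiArrow.pi)

/-- The arrow `ϑ` in the path algebra. -/
noncomputable def theta : PathAlgebra ℚ Psi :=
  PathAlgebra.arrow ℚ (show Psi.v4 ⟶ Psi.v2 from PsiArrow.theta)

/-- The arrow `σ` in the path algebra. -/
noncomputable def sigma : PathAlgebra ℚ Psi :=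
  PathAlgebra.arrow ℚ (show Psi.v2 ⟶ Psi.v4 from PsiArrow.sigma)

/-- The two-sided ideal `I = (π ρ, σ ϑ, π ϑ, σ ρ)` of `ℚ Ψ`. -/
noncomputable def relIdeal : TwoSidedIdeal (PathAlgebra ℚ Psi) :=
  TwoSidedIdeal.span {pi * rho, sigma * theta, pi * theta, sigma * rho}

/-- The path algebra modulo relations `ℚ Ψ / I`. -/
abbrev PathQuot : Type := relIdeal.ringCon.Quotient

/-- The quotient map `ℚ Ψ → ℚ Ψ / I`. -/
noncomputable def toQuot (x : PathAlgebra ℚ Psi) : PathQuot := relIdeal.ringCon.mk' x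

end Psi

end Psi

/-! The corner `A'` has basis `1, η, ξ` in its last block, one matrix unit for each of the seven
other nonzero blocks, so dimension 10. In it `a₄₁ a₁₄ = η` and `a₄₂ a₂₄ = ξ - 12 η`, while the
products corresponding to `π ρ`, `σ ϑ`, `π ϑ`, `σ ρ` vanish. Hence sending paths to products of the
`a i j` factors through `ℚ Ψ / I` (`evalQuot`). The four vertices, the four arrows and `ρ π`, `ϑ σ`
map to a basis of the corner; reading off coordinates in it gives an explicit inverse `toPathQuot`.
That this inverse respects right multiplication by arrows (`toPathQuot_mul_ofArrow`) shows that no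
relations beyond `I` are needed.

The idempotent `a` is full: `1` is a sum of three terms `x a y` (`AlgA.cornerIdem_full`). For a full
idempotent `e`, the functor `M ↦ e M` is an equivalence of module categories
(`cornerFunctor_isEquivalence`), and it is linear over the base ring. This gives the Morita
equivalences once `A ≅ B` is known.

For `A ≅ B`, a conjugation invariant function `Φ` from subgroups of `G × G` to an algebra gives the
map `M ↦ ∑ Φ (stab m)` on bisets. It is additive on disjoint unions, and orbit counting turns its
multiplicativity into an averaged identity for pairs of subgroups (`stabSum_tensor`). For `G = S₃`
there are 22 representatives of subgroups up to conjugacy, found by an exhaustive verified search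
(`exists_hasCode`), and `dim A = 22`. The values of `Φ` are listed in a table of integers. The
identity for pairs is checked on representatives (`table_mul`), and `table_mul_invTable` inverts the
table as a matrix. Since the corresponding transitive bisets span `B`, invertibility makes the
homomorphism `B → A` bijective. -/

/-! ## Morita equivalence of a ring with the corner at a full idempotent -/

section CornerMorita

open CategoryTheory

open scoped ModuleCat.Algebra

variable {S : Type v} [Ring S] {e : S}

/-- The subgroup `e M` of an `S`-module `M`. -/
def cornerSubgroup (_ : IsIdempotentElem e) (M : Type w) [AddCommGroup M] [Module S M] :
    AddSubgroup M where
  carrier := {m | e • m = m}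
  add_mem' {a b} ha hb := by
    change e • (a + b) = a + b
    rw [smul_add, show e • a = a from ha, show e • b = b from hb]
  zero_mem' := smul_zero e
  neg_mem' {a} ha := by
    change e • (-a) = -a
    rw [smul_neg, show e • a = a from ha]

variable (he : IsIdempotentElem e)

theorem corner_left_mul (x : he.Corner) : e * x.1 = x.1 :=
  ((Subsemigroup.mem_corner_iff he).1 x.2).1

theorem corner_right_mul (x : he.Corner) : x.1 * e = x.1 :=
  ((Subsemigroup.mem_corner_iff he).1 x.2).2

/-- The element `e s e` of the corner. -/
def cornerMk (s : S) : he.Corner := ⟨e * s * e, s, rfl⟩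

section

variable {M : Type w} [AddCommGroup M] [Module S M]

/-- The element `e m` of `e M`. -/
def cornerSubgroupMk (m : M) : cornerSubgroup he M :=
  ⟨e • m, by
    change e • e • m = e • m
    rw [← mul_smul, he.eq]⟩

theorem cornerSubgroup_smul (m : cornerSubgroup he M) : e • m.1 = m.1 := m.2

instance : Module he.Corner (cornerSubgroup he M) where
  smul x m := ⟨x.1 • m.1, by
    change e • x.1 • m.1 = x.1 • m.1
    rw [← mul_smul, corner_left_mul]⟩
  one_smul m := Subtype.ext m.2
  mul_smul x y m := Subtype.ext (mul_smul x.1 y.1 m.1)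
  smul_zero x := Subtype.ext (smul_zero x.1)
  smul_add x m n := Subtype.ext (smul_add x.1 m.1 n.1)
  add_smul x y m := Subtype.ext (add_smul x.1 y.1 m.1)
  zero_smul m := Subtype.ext (zero_smul S m.1)

theorem cornerSubgroup_coe_smul (x : he.Corner) (m : cornerSubgroup he M) :
    (x • m).1 = x.1 • m.1 := rfl

variable {N : Type w} [AddCommGroup N] [Module S N]

/-- The map `e M → e N` induced by a linear map `M → N`. -/
def cornerMap (f : M →ₗ[S] N) : cornerSubgroup he M →ₗ[he.Corner] cornerSubgroup he N where
  toFun m := ⟨f m.1, by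
    change e • f m.1 = f m.1
    rw [← map_smul, cornerSubgroup_smul]⟩
  map_add' m n := Subtype.ext (map_add f m.1 n.1)
  map_smul' x m := Subtype.ext (map_smul f x.1 m.1)

theorem cornerMap_coe (f : M →ₗ[S] N) (m : cornerSubgroup he M) :
    (cornerMap he f m).1 = f m.1 := rfl

variable {ι : Type*} [Fintype ι] {a b : ι → S}

/-- Fullness gives `m = ∑ a i • (e b i m)`, so a linear map on `M` is determined by its values on `e
M`. -/
theorem cornerMap_injective (hab : ∑ i, a i * e * b i = 1) :
    Function.Injective (cornerMap he (M := M) (N := N)) := by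
  intro f g h
  ext m
  have key : ∀ k : M →ₗ[S] N, k m = ∑ i, a i • (cornerMap he k (cornerSubgroupMk he (b i • m))).1 :=
    fun k => by
      conv_lhs => rw [← one_smul S m, ← hab, Finset.sum_smul, map_sum]
      refine Finset.sum_congr rfl fun i _ => ?_
      rw [cornerMap_coe, ← map_smul]
      simp only [cornerSubgroupMk, mul_smul]
  rw [key f, key g, h]

/-- The only possible extension of `g` is `m ↦ ∑ a i • g (e b i m)`. Linearity over all of `S`, and
not only over the corner, follows by inserting the expansion of `1` a second time. -/
theorem cornerMap_surjective (hab : ∑ i, a i * e * b i = 1) :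
    Function.Surjective (cornerMap he (M := M) (N := N)) := by
  intro g
  -- This is linearity of `g` for the corner element `e s e`, applied to the vector `e m`.
  have hg : ∀ (s : S) (m : M),
      e • s • (g (cornerSubgroupMk he m)).1 = (g (cornerSubgroupMk he (s • e • m))).1 := by
    intro s m
    have h := congrArg Subtype.val (map_smul g (cornerMk he s) (cornerSubgroupMk he m))
    rw [cornerSubgroup_coe_smul] at h
    change _ = (e * s * e) • _ at h
    rw [mul_smul, mul_smul, cornerSubgroup_smul] at h
    rw [← h]
    refine congrArg (fun z => (g z).1) (Subtype.ext ?_)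
    change (e * s * e) • e • m = e • s • e • m
    simp only [← mul_smul, mul_assoc, he.eq]
  let ext : M →ₗ[S] N :=
    { toFun := fun m => ∑ i, a i • (g (cornerSubgroupMk he (b i • m))).1
      map_add' := fun m n => by
        rw [← Finset.sum_add_distrib]
        refine Finset.sum_congr rfl fun i _ => ?_
        rw [← smul_add, ← AddSubgroup.coe_add, ← map_add]
        refine congrArg (fun z => a i • (g z).1) (Subtype.ext ?_)
        simp [cornerSubgroupMk]
      map_smul' := fun s m => by
        have h1 : ∀ i, (g (cornerSubgroupMk he (b i • s • m))).1 =
            ∑ j, e • (b i * s * a j) • (g (cornerSubgroupMk he (b j • m))).1 := by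
          intro i
          simp only [hg]
          rw [← AddSubgroup.val_finsetSum, ← map_sum]
          refine congrArg (fun z => (g z).1) (Subtype.ext ?_)
          rw [AddSubgroup.val_finsetSum]
          simp only [cornerSubgroupMk, ← mul_smul, ← Finset.sum_smul]
          congr 1
          -- The factor `1 = ∑ a j e b j` is put to the right of `s`, so that `g` is evaluated only
          -- at the vectors `e b j m`. The sum over `i` then collapses by the same identity.
          calc e * (b i * s) = e * (b i * s * ∑ j, a j * e * b j) := by rw [hab, mul_one]
            _ = _ := by simp only [Finset.mul_sum, mul_assoc]
        simp only [h1, Finset.smul_sum, RingHom.id_apply]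
        rw [Finset.sum_comm]
        refine Finset.sum_congr rfl fun j _ => ?_
        simp only [← mul_smul, ← Finset.sum_smul]
        congr 1
        calc ∑ i, a i * (e * (b i * s * a j)) = (∑ i, a i * e * b i) * (s * a j) := by
              simp only [Finset.sum_mul, mul_assoc]
          _ = _ := by rw [hab, one_mul] }
  refine ⟨ext, ?_⟩
  ext m
  rw [cornerMap_coe]
  change ∑ i, a i • (g (cornerSubgroupMk he (b i • m.1))).1 = (g m).1
  have h2 : ∀ i, (g (cornerSubgroupMk he (b i • m.1))).1 = e • b i • (g m).1 := by
    intro i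
    have hm : cornerSubgroupMk he m.1 = m := Subtype.ext m.2
    conv_rhs => rw [← hm, hg, cornerSubgroup_smul]
  simp only [h2, ← mul_smul, ← Finset.sum_smul]
  simp only [← mul_assoc, hab, one_smul]

end

/-- The functor `M ↦ e M` from `S`-modules to `e S e`-modules. -/
@[simps]
def cornerFunctor : ModuleCat.{w} S ⥤ ModuleCat.{w} he.Corner where
  obj M := ModuleCat.of he.Corner (cornerSubgroup he M)
  map f := ModuleCat.ofHom (cornerMap he f.hom)

/-! ### Coinduced modules, the preimages under the corner functor. -/

section Coinduced

variable (N : Type (max v w)) [AddCommGroup N] [Module he.Corner N]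

/-- The `S`-module `Hom (e S, N)` for an `e S e`-module `N`, as a group of additive maps on `S`. -/
def cornerCoind : AddSubgroup (S → N) where
  carrier := {φ | (∀ s t, φ (s + t) = φ s + φ t) ∧ (∀ s, φ (e * s) = φ s) ∧
    ∀ (x : he.Corner) s, φ (x.1 * s) = x • φ s}
  add_mem' {φ ψ} hφ hψ := by
    refine ⟨fun s t => ?_, fun s => ?_, fun x s => ?_⟩
    · simp only [Pi.add_apply, hφ.1, hψ.1]; abel
    · simp only [Pi.add_apply, hφ.2.1, hψ.2.1]
    · simp only [Pi.add_apply, hφ.2.2, hψ.2.2, smul_add]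
  zero_mem' := by simp
  neg_mem' {φ} hφ := by
    refine ⟨fun s t => ?_, fun s => ?_, fun x s => ?_⟩
    · simp only [Pi.neg_apply, hφ.1]; abel
    · simp only [Pi.neg_apply, hφ.2.1]
    · simp only [Pi.neg_apply, hφ.2.2, smul_neg]

variable {N}

theorem cornerCoind_zero (φ : cornerCoind he N) : φ.1 0 = 0 := by
  have h := φ.2.1 0 0
  rw [add_zero] at h
  exact left_eq_add.1 h

instance : Module S (cornerCoind he N) where
  smul s φ := ⟨fun t => φ.1 (t * s), fun t t' => (congrArg φ.1 (add_mul t t' s)).trans (φ.2.1 _ _),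
    fun t => (congrArg φ.1 (mul_assoc e t s)).trans (φ.2.2.1 _),
    fun x t => (congrArg φ.1 (mul_assoc x.1 t s)).trans (φ.2.2.2 _ _)⟩
  one_smul φ := Subtype.ext (funext fun t => congrArg φ.1 (mul_one t))
  mul_smul s s' φ := Subtype.ext (funext fun t => congrArg φ.1 (mul_assoc t s s').symm)
  smul_zero _ := rfl
  smul_add _ _ _ := rfl
  add_smul s s' φ := Subtype.ext (funext fun t =>
    (congrArg φ.1 (mul_add t s s')).trans (φ.2.1 _ _))
  zero_smul φ := Subtype.ext (funext fun t =>
    (congrArg φ.1 (mul_zero t)).trans (cornerCoind_zero he φ))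

/-- Evaluation at `e` identifies `e Hom (e S, N)` with `N`. -/
def cornerCoindEquiv : cornerSubgroup he (cornerCoind he N) ≃ₗ[he.Corner] N where
  toFun φ := φ.1.1 e
  map_add' φ ψ := rfl
  map_smul' x φ := by
    have h := φ.1.2.2.2 x e
    rw [corner_right_mul] at h
    change φ.1.1 (e * x.1) = _
    rw [corner_left_mul]
    exact h
  invFun n := ⟨⟨fun s => cornerMk he s • n, fun s t => by
      rw [← add_smul]
      refine congrArg (· • n) (Subtype.ext ?_)
      change e * (s + t) * e = e * s * e + e * t * e
      rw [mul_add, add_mul], fun s => by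
      refine congrArg (· • n) (Subtype.ext ?_)
      change e * (e * s) * e = e * s * e
      rw [← mul_assoc e, he.eq], fun x s => by
      rw [← mul_smul]
      refine congrArg (· • n) (Subtype.ext ?_)
      change e * (x.1 * s) * e = x.1 * (e * s * e)
      rw [← mul_assoc e, corner_left_mul, ← mul_assoc x.1, ← mul_assoc x.1, corner_right_mul]⟩, by
      refine Subtype.ext (funext fun s => ?_)
      refine congrArg (· • n) (Subtype.ext ?_)
      change e * (s * e) * e = e * s * e
      simp only [mul_assoc, he.eq]⟩
  left_inv φ := by
    refine Subtype.ext (Subtype.ext (funext fun s => ?_))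
    change cornerMk he s • φ.1.1 e = φ.1.1 s
    rw [← φ.1.2.2.2]
    change φ.1.1 (e * s * e * e) = _
    rw [mul_assoc, he.eq, mul_assoc, φ.1.2.2.1]
    -- As `S` acts by right translation of the argument, lying in the part cut out by `e` means `φ
    -- (s e) = φ s`.
    exact congrFun (congrArg Subtype.val φ.2) s
  right_inv n := by
    change cornerMk he e • n = n
    have h : cornerMk he e = 1 := Subtype.ext (by
      change e * e * e = e
      rw [he.eq, he.eq])
    rw [h, one_smul]

end Coinduced

variable {ι : Type*} [Fintype ι] {a b : ι → S}

/-- Fullness of `e` is used only for the bijection on morphisms; coinduced modules give essential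
surjectivity for any idempotent. They consist of functions on `S`, hence the universe `max v w` for
the modules. -/
theorem cornerFunctor_isEquivalence (hab : ∑ i, a i * e * b i = 1) :
    (cornerFunctor.{v, max v w} he).IsEquivalence where
  faithful := ⟨fun {M N} f g h =>
    ModuleCat.hom_ext (cornerMap_injective he hab (congrArg ModuleCat.Hom.hom h))⟩
  full := ⟨fun {M N} f => by
    obtain ⟨g, hg⟩ := cornerMap_surjective he hab (M := M) (N := N) f.hom
    exact ⟨ModuleCat.ofHom g, ModuleCat.hom_ext hg⟩⟩
  essSurj := ⟨fun N => ⟨ModuleCat.of S (cornerCoind he N),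
    ⟨LinearEquiv.toModuleIso (cornerCoindEquiv he (N := N))⟩⟩⟩

variable (R : Type u) [CommRing R] [Algebra R S]

/-- A scalar `r` acts on `e M` through the image `r e` of `r` in the corner, and `e` is the identity
there. -/
instance cornerFunctor_linear : (cornerFunctor.{v, w} he).Linear R where
  map_smul {M N} f r := by
    ext m
    refine Subtype.ext ?_
    change algebraMap R S r • f.hom m.1 = (algebraMap R he.Corner r).1 • f.hom m.1
    have h : (algebraMap R he.Corner r).1 = algebraMap R S r * e := by
      rw [Algebra.algebraMap_eq_smul_one, corner_coe_smul, Algebra.smul_def]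
      rfl
    rw [h, mul_smul, ← map_smul f.hom e]
    exact congrArg (fun z => algebraMap R S r • f.hom z) (cornerSubgroup_smul he m).symm

end CornerMorita

/-! ## Coordinates on the local algebra -/

section LocalCoordinates

/-- The isomorphic copy `ℚ ⊕ ℚ²` of the local algebra, with `ℚ²` an ideal of square zero. -/
noncomputable def localToTriv : LocalAlg →ₐ[ℚ] TrivSqZeroExt ℚ (ℚ × ℚ) :=
  Ideal.Quotient.liftₐ localIdeal
    (MvPolynomial.aeval fun i : Fin 2 =>
      (TrivSqZeroExt.inr (if i = 0 then (1, 0) else (0, 1)) : TrivSqZeroExt ℚ (ℚ × ℚ))) (by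
    intro a ha
    have : localIdeal ≤ RingHom.ker (MvPolynomial.aeval fun i : Fin 2 =>
      (TrivSqZeroExt.inr (if i = 0 then (1, 0) else (0, 1)) : TrivSqZeroExt ℚ (ℚ × ℚ))) := by
      unfold localIdeal
      rw [Ideal.span_le]
      rintro x (rfl | rfl | rfl) <;> simp [RingHom.mem_ker, pow_two]
    exact this ha)

theorem localToTriv_eta : localToTriv etaBar = TrivSqZeroExt.inr (1, 0) := by
  change MvPolynomial.aeval _ (MvPolynomial.X 0) = _
  simp

theorem localToTriv_xi : localToTriv xiBar = TrivSqZeroExt.inr (0, 1) := by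
  change MvPolynomial.aeval _ (MvPolynomial.X 1) = _
  simp

/-- The map `a + b η + c ξ ↦ b`. -/
noncomputable def localEta : LocalAlg →ₗ[ℚ] ℚ :=
  LinearMap.fst ℚ ℚ ℚ ∘ₗ TrivSqZeroExt.sndHom ℚ (ℚ × ℚ) ∘ₗ localToTriv.toLinearMap

/-- The map `a + b η + c ξ ↦ c`. -/
noncomputable def localXi : LocalAlg →ₗ[ℚ] ℚ :=
  LinearMap.snd ℚ ℚ ℚ ∘ₗ TrivSqZeroExt.sndHom ℚ (ℚ × ℚ) ∘ₗ localToTriv.toLinearMap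

theorem localEta_apply (x : LocalAlg) : localEta x = (localToTriv x).snd.1 := rfl

theorem localXi_apply (x : LocalAlg) : localXi x = (localToTriv x).snd.2 := rfl

@[simp] theorem localEta_eta : localEta etaBar = 1 := by
  simp [localEta_apply, localToTriv_eta]

@[simp] theorem localEta_xi : localEta xiBar = 0 := by
  simp [localEta_apply, localToTriv_xi]

@[simp] theorem localEta_one : localEta 1 = 0 := by
  simp [localEta_apply]

@[simp] theorem localXi_eta : localXi etaBar = 0 := by
  simp [localXi_apply, localToTriv_eta]

@[simp] theorem localXi_xi : localXi xiBar = 1 := by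
  simp [localXi_apply, localToTriv_xi]

@[simp] theorem localXi_one : localXi 1 = 0 := by
  simp [localXi_apply]

/-- `local_exists_form` provides some coefficients; the functionals `localAug`, `localEta` and
`localXi` recover them, so that `1, η, ξ` is a basis. -/
theorem local_eq_coordinates (x : LocalAlg) :
    x = localAug x • 1 + localEta x • etaBar + localXi x • xiBar := by
  obtain ⟨a, b, c, rfl⟩ := local_exists_form x
  simp [localAug_eta, localAug_xi, Algebra.algebraMap_eq_smul_one]

end LocalCoordinates

/-! ## The corner of `A` as a path algebra modulo relations -/

section CornerPath

open PathAlgebra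

namespace CornerA

theorem coe_mul (x y : CornerA) : (x * y).1 = x.1 * y.1 := rfl

theorem coe_add (x y : CornerA) : (x + y).1 = x.1 + y.1 := rfl

theorem coe_zero : (0 : CornerA).1 = 0 := rfl

theorem coe_smul (r : ℚ) (x : CornerA) : (r • x).1 = r • x.1 := rfl

theorem coe_smul_mul_smul (r s : ℚ) (x y : CornerA) : r • x * s • y = (r * s) • (x * y) := by
  refine Subtype.ext ?_
  rw [coe_mul, coe_smul, coe_smul, coe_smul, coe_mul, smul_mul_smul_comm]

/-- The idempotent of the corner belonging to a vertex. -/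
noncomputable def ofVertex : Psi → CornerA
  | .v1 => a11
  | .v2 => a22
  | .v3 => a33
  | .v4 => a44

/-- The element of the corner belonging to an arrow. -/
noncomputable def ofArrow : ∀ {a b : Psi}, PsiArrow a b → CornerA
  | _, _, .rho => a41
  | _, _, .pi => a14
  | _, _, .theta => a42
  | _, _, .sigma => a24

/-- The element of the corner belonging to a path. -/
noncomputable def ofPath {a : Psi} : ∀ {b : Psi}, Quiver.Path a b → CornerA
  | _, .nil => ofVertex a
  | _, .cons p f => ofPath p * ofArrow f

theorem ofVertex_mul_self (a : Psi) : ofVertex a * ofVertex a = ofVertex a := by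
  refine Subtype.ext ?_
  rw [coe_mul]
  cases a <;> simp only [ofVertex, a11, a22, a33, a44] <;> ext1 <;>
    simp [AlgA.a11, AlgA.a22, AlgA.a33, AlgA.a44]

theorem ofVertex_mul_of_ne {a b : Psi} (h : a ≠ b) : ofVertex a * ofVertex b = 0 := by
  refine Subtype.ext ?_
  rw [coe_mul]
  cases a <;> cases b <;> first | exact absurd rfl h | skip
  all_goals
    simp only [ofVertex, a11, a22, a33, a44, coe_zero]
    ext1 <;> simp [AlgA.a11, AlgA.a22, AlgA.a33, AlgA.a44]

theorem ofVertex_mul_ofArrow {a b : Psi} (f : PsiArrow a b) :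
    ofVertex a * ofArrow f = ofArrow f := by
  refine Subtype.ext ?_
  rw [coe_mul]
  cases f <;> simp only [ofVertex, ofArrow, a11, a22, a44, a14, a41, a24, a42] <;> ext1 <;>
    simp [AlgA.a11, AlgA.a22, AlgA.a44, AlgA.a14, AlgA.a41, AlgA.a24, AlgA.a42]

theorem ofArrow_mul_ofVertex {a b : Psi} (f : PsiArrow a b) :
    ofArrow f * ofVertex b = ofArrow f := by
  refine Subtype.ext ?_
  rw [coe_mul]
  cases f <;> simp only [ofVertex, ofArrow, a11, a22, a44, a14, a41, a24, a42] <;> ext1 <;>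
    simp [AlgA.a11, AlgA.a22, AlgA.a44, AlgA.a14, AlgA.a41, AlgA.a24, AlgA.a42]

theorem ofVertex_mul_ofPath {a b : Psi} (p : Quiver.Path a b) :
    ofVertex a * ofPath p = ofPath p := by
  induction p with
  | nil => exact ofVertex_mul_self a
  | cons p f ih => rw [ofPath, ← mul_assoc, ih]

theorem ofPath_mul_ofVertex {a b : Psi} (p : Quiver.Path a b) :
    ofPath p * ofVertex b = ofPath p := by
  cases p with
  | nil => exact ofVertex_mul_self a
  | cons p f => rw [ofPath, mul_assoc, ofArrow_mul_ofVertex]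

theorem ofPath_comp {a b c : Psi} (p : Quiver.Path a b) (q : Quiver.Path b c) :
    ofPath (p.comp q) = ofPath p * ofPath q := by
  induction q with
  | nil => exact (ofPath_mul_ofVertex p).symm
  | cons q f ih => rw [Quiver.Path.comp_cons, ofPath, ofPath, ih, mul_assoc]

/-- The idempotents of the end of `p` and of the start of `q` can be inserted between the factors,
and they are orthogonal. -/
theorem ofPath_mul_ofPath_of_ne {a b c d : Psi} (p : Quiver.Path a b) (q : Quiver.Path c d)
    (h : b ≠ c) : ofPath p * ofPath q = 0 := by
  rw [← ofPath_mul_ofVertex p, ← ofVertex_mul_ofPath q, mul_assoc, ← mul_assoc (ofVertex b),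
    ofVertex_mul_of_ne h, zero_mul, mul_zero]

/-- The linear map from the path algebra that extends `ofPath`. -/
noncomputable def evalLinear : PathAlgebra ℚ Psi →ₗ[ℚ] CornerA :=
  Finsupp.lift CornerA ℚ (QuiverPath Psi) fun p => ofPath p.2.2

theorem evalLinear_ofPath {a b : Psi} (p : Quiver.Path a b) :
    evalLinear (PathAlgebra.ofPath ℚ p) = ofPath p :=
  (Finsupp.lift_apply _ _ _ _ _).trans ((Finsupp.sum_single_index (h := fun (q : QuiverPath Psi) (r : ℚ) =>
    r • ofPath q.2.2) (Subtype.ext (zero_smul ℚ (ofPath p).1))).trans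
    (Subtype.ext (one_smul ℚ (ofPath p).1)))

theorem sum_ofVertex : ∑ a : Psi, ofVertex a = 1 := by
  have h : (Finset.univ : Finset Psi) = {.v1, .v2, .v3, .v4} := rfl
  rw [h]
  refine Subtype.ext ?_
  have h' : ∑ a ∈ ({.v1, .v2, .v3, .v4} : Finset Psi), ofVertex a =
      ofVertex .v1 + ofVertex .v2 + ofVertex .v3 + ofVertex .v4 := by
    simp [add_assoc]
  rw [h', coe_add, coe_add, coe_add]
  rfl

/-- The homomorphism from the path algebra to the corner. -/
noncomputable def eval : PathAlgebra ℚ Psi →ₐ[ℚ] CornerA :=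
  AlgHom.ofLinearMap evalLinear
    (by
      rw [one_def, map_sum]
      simp only [vertex, evalLinear_ofPath]
      exact sum_ofVertex)
    (by
      intro x y
      induction x using induction_path with
      | zero => rw [zero_mul, map_zero, zero_mul]
      | add x x' h h' => rw [add_mul, map_add, map_add, add_mul, h, h']
      | path r p =>
        induction y using induction_path with
        | zero => rw [mul_zero, map_zero, mul_zero]
        | add y y' h h' => rw [mul_add, map_add, map_add, mul_add, h, h']
        | path s q =>
          rename_i a b c d
          rw [smul_mul_smul_comm, map_smul, map_smul, map_smul, coe_smul_mul_smul,
            evalLinear_ofPath, evalLinear_ofPath]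
          by_cases h : b = c
          · subst h
            rw [ofPath_mul_ofPath, evalLinear_ofPath, ofPath_comp]
          · rw [PathAlgebra.ofPath_mul_ofPath_of_ne p q h, map_zero, ofPath_mul_ofPath_of_ne p q h])

theorem eval_ofPath {a b : Psi} (p : Quiver.Path a b) :
    eval (PathAlgebra.ofPath ℚ p) = ofPath p := evalLinear_ofPath p

theorem eval_vertex (a : Psi) : eval (vertex ℚ a) = ofVertex a := evalLinear_ofPath _

theorem eval_arrow {a b : Psi} (f : a ⟶ b) : eval (arrow ℚ f) = ofArrow f := by
  rw [arrow, eval_ofPath, Quiver.Hom.toPath, ofPath, ofPath, ofVertex_mul_ofArrow]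

/-- The relations `π ρ` and `σ ϑ` hold because the products into `A 1 1` and `A 2 2` through the
fourth index are zero by definition; `π ϑ` and `σ ρ` would land in the zero blocks `A 1 2` and `A 2
1`. -/
theorem eval_relIdeal : Psi.relIdeal.ringCon ≤ RingCon.ker eval.toRingHom := by
  have h : Psi.relIdeal ≤ TwoSidedIdeal.ker eval.toRingHom := by
    refine TwoSidedIdeal.span_le.2 ?_
    rintro x (rfl | rfl | rfl | rfl) <;> rw [SetLike.mem_coe, TwoSidedIdeal.mem_ker]
    all_goals
      change eval _ = 0
      simp only [Psi.pi, Psi.rho, Psi.theta, Psi.sigma]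
      rw [map_mul, eval_arrow, eval_arrow]
      refine Subtype.ext ?_
      rw [coe_mul]
      simp only [ofArrow, a14, a41, a24, a42, coe_zero]
      ext1 <;> simp [AlgA.a14, AlgA.a41, AlgA.a24, AlgA.a42]
  intro x y hxy
  have hm := h ((TwoSidedIdeal.rel_iff _ _ _).1 hxy)
  rw [TwoSidedIdeal.mem_ker, map_sub, sub_eq_zero] at hm
  exact hm

/-- The homomorphism from the path algebra modulo relations to the corner. -/
noncomputable def evalQuot : Psi.PathQuot →ₐ[ℚ] CornerA :=
  Psi.relIdeal.ringCon.liftₐ eval eval_relIdeal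

theorem evalQuot_toQuot (x : PathAlgebra ℚ Psi) : evalQuot (Psi.toQuot x) = eval x := rfl

end CornerA

namespace Psi

theorem toQuot_mul (x y : PathAlgebra ℚ Psi) : toQuot x * toQuot y = toQuot (x * y) := rfl

theorem toQuot_zero : toQuot 0 = 0 := rfl

theorem toQuot_eq_zero {x : PathAlgebra ℚ Psi} (h : x ∈ relIdeal) : toQuot x = 0 :=
  (RingCon.eq _).2 ((TwoSidedIdeal.mem_iff _ _).1 h)

theorem toQuot_surjective : Function.Surjective toQuot :=
  RingCon.mk'_surjective _

theorem toQuot_ofPath_mul_of_ne {a b c d : Psi} (p : Quiver.Path a b) (q : Quiver.Path c d)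
    (h : b ≠ c) : toQuot (ofPath ℚ p) * toQuot (ofPath ℚ q) = 0 := by
  rw [toQuot_mul, PathAlgebra.ofPath_mul_ofPath_of_ne p q h, toQuot_zero]

theorem toQuot_vertex_mul_arrow {a b : Psi} (f : a ⟶ b) :
    toQuot (vertex ℚ a) * toQuot (arrow ℚ f) = toQuot (arrow ℚ f) := by
  rw [toQuot_mul, vertex, arrow, PathAlgebra.ofPath_mul_ofPath, Quiver.Path.nil_comp]

theorem toQuot_relations :
    toQuot pi * toQuot rho = 0 ∧ toQuot sigma * toQuot theta = 0 ∧
      toQuot pi * toQuot theta = 0 ∧ toQuot sigma * toQuot rho = 0 := by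
  refine ⟨?_, ?_, ?_, ?_⟩ <;>
    exact toQuot_eq_zero (TwoSidedIdeal.subset_span (by simp))

end Psi

namespace CornerA

open Psi

/-- The linear map from `A` to the path algebra modulo relations that is inverse to `evalQuot` on
the corner. -/
noncomputable def toPathQuot (x : AlgA) : PathQuot :=
  x.x11 0 0 • toQuot (vertex ℚ v1) + x.x22 • toQuot (vertex ℚ v2) +
    x.x33 • toQuot (vertex ℚ v3) + localAug x.x44 • toQuot (vertex ℚ v4) +
    x.x14 0 0 • toQuot pi + x.x41 0 0 • toQuot rho + x.x24 • toQuot sigma +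
    -- Since `ρ π` maps to `η` and `ϑ σ` to `ξ - 12 η`, the element `b η + c ξ` is `(b + 12 c) η + c
    -- (ξ - 12 η)`.
    x.x42 • toQuot theta + (localEta x.x44 + 12 * localXi x.x44) • (toQuot rho * toQuot pi) +
    localXi x.x44 • (toQuot theta * toQuot sigma)

theorem toPathQuot_add (x y : AlgA) : toPathQuot (x + y) = toPathQuot x + toPathQuot y := by
  simp only [toPathQuot, AlgA.add_x11, AlgA.add_x14, AlgA.add_x22, AlgA.add_x24, AlgA.add_x33,
    AlgA.add_x41, AlgA.add_x42, AlgA.add_x44, Matrix.add_apply, map_add]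
  module

theorem toPathQuot_smul (r : ℚ) (x : AlgA) : toPathQuot (r • x) = r • toPathQuot x := by
  simp only [toPathQuot, AlgA.smul_x11, AlgA.smul_x14, AlgA.smul_x22, AlgA.smul_x24,
    AlgA.smul_x33, AlgA.smul_x41, AlgA.smul_x42, AlgA.smul_x44, Matrix.smul_apply, map_smul,
    smul_eq_mul]
  module

/-- This drives the induction over paths in `toPathQuot_ofPath`, and replaces a separate treatment
of long paths. It holds on all of `A`, since right multiplication by an arrow needs only the entries
that `toPathQuot` records. -/
theorem toPathQuot_mul_ofArrow (x : AlgA) {a b : Psi} (f : PsiArrow a b) :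
    toPathQuot (x * (ofArrow f).1) = toPathQuot x * toQuot (arrow ℚ (show a ⟶ b from f)) := by
  obtain ⟨h1, h2, h3, h4⟩ := toQuot_relations
  have hv : ∀ {c d : Psi} (g : c ⟶ d) (c' : Psi), c' ≠ c →
      toQuot (vertex ℚ c') * toQuot (arrow ℚ g) = 0 :=
    fun g c' h => toQuot_ofPath_mul_of_ne _ _ h
  have hw : ∀ {c d c' d' : Psi} (g : c ⟶ d) (g' : c' ⟶ d'), d ≠ c' →
      toQuot (arrow ℚ g) * toQuot (arrow ℚ g') = 0 :=
    fun g g' h => toQuot_ofPath_mul_of_ne _ _ h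
  have hs : ∀ (r : ℚ) (y z : PathQuot), r • y * z = r • (y * z) := fun r y z => smul_mul_assoc r y z
  simp only [pi, rho, theta, sigma] at h1 h2 h3 h4
  cases f
  all_goals
    simp only [toPathQuot, add_mul, hs, mul_assoc, pi, rho, theta, sigma]
    simp (disch := decide) only [h1, h2, h3, h4, hv, hw, toQuot_vertex_mul_arrow]
    simp [ofArrow, a14, a41, a24, a42, AlgA.a14, AlgA.a41, AlgA.a24, AlgA.a42, localAug_eta,
      localAug_xi, mul_comm]

theorem toPathQuot_ofVertex (a : Psi) : toPathQuot (ofVertex a).1 = toQuot (vertex ℚ a) := by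
  cases a <;> simp [toPathQuot, ofVertex, a11, a22, a33, a44, AlgA.a11, AlgA.a22, AlgA.a33,
    AlgA.a44]

theorem toPathQuot_ofPath {a b : Psi} (p : Quiver.Path a b) :
    toPathQuot (ofPath p).1 = toQuot (PathAlgebra.ofPath ℚ p) := by
  induction p with
  | nil => exact toPathQuot_ofVertex a
  | cons p f ih =>
    rw [ofPath, coe_mul, toPathQuot_mul_ofArrow, ih, toQuot_mul, arrow,
      PathAlgebra.ofPath_mul_ofPath]
    rfl

/-- This yields injectivity of `evalQuot`: the kernel of the evaluation on the path algebra is no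
larger than `I`. -/
theorem toPathQuot_evalQuot (y : PathQuot) : toPathQuot (evalQuot y).1 = y := by
  obtain ⟨x, rfl⟩ := toQuot_surjective y
  rw [evalQuot_toQuot]
  induction x using induction_path with
  | zero => rw [map_zero, coe_zero, ← zero_smul ℚ (0 : AlgA), toPathQuot_smul, zero_smul]; rfl
  | add x y h k => rw [map_add, coe_add, toPathQuot_add, h, k]; rfl
  | path r p => rw [map_smul, coe_smul, toPathQuot_smul, eval_ofPath, toPathQuot_ofPath]; rfl

theorem evalQuot_toPathQuot (x : CornerA) : evalQuot (toPathQuot x.1) = x := by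
  -- Writing `x` as `a x a` shows that its matrix blocks vanish outside the first entries, the only
  -- ones that `toPathQuot` sees.
  have hx : AlgA.cornerIdem * x.1 * AlgA.cornerIdem = x.1 := by
    have h := (Subsemigroup.mem_corner_iff AlgA.cornerIdem_isIdempotentElem).1 x.2
    rw [h.1, h.2]
  refine Subtype.ext ?_
  simp only [toPathQuot, map_add, map_mul, map_smul, evalQuot_toQuot, eval_vertex, pi, rho, theta,
    sigma, eval_arrow, coe_add, coe_smul, coe_mul]
  simp only [ofVertex, ofArrow, a11, a22, a33, a44, a14, a41, a24, a42]
  conv_rhs => rw [← hx]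
  ext1
  case x44 =>
    conv_rhs => rw [hx, local_eq_coordinates x.1.x44]
    simp [AlgA.a11, AlgA.a22, AlgA.a33, AlgA.a44, AlgA.a14, AlgA.a41, AlgA.a24, AlgA.a42]
    module
  all_goals
    simp [AlgA.cornerIdem, AlgA.a11, AlgA.a22, AlgA.a33, AlgA.a44, AlgA.a14, AlgA.a41, AlgA.a24,
      AlgA.a42]
  case x14 => ext i j; fin_cases i <;> fin_cases j <;> simp
  case x41 => ext i j; fin_cases i; fin_cases j <;> simp

/-- The corner of `A` is isomorphic to the path algebra modulo relations. -/
noncomputable def equivPathQuot : CornerA ≃ₐ[ℚ] PathQuot :=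
  (AlgEquiv.ofBijective evalQuot
    ⟨fun x y h => by rw [← toPathQuot_evalQuot x, h, toPathQuot_evalQuot],
      fun x => ⟨_, evalQuot_toPathQuot x⟩⟩).symm

theorem equivPathQuot_ofVertex (a : Psi) :
    equivPathQuot (ofVertex a) = toQuot (vertex ℚ a) := by
  rw [equivPathQuot, AlgEquiv.symm_apply_eq]
  exact (eval_vertex a).symm

theorem equivPathQuot_ofArrow {a b : Psi} (f : PsiArrow a b) :
    equivPathQuot (ofArrow f) = toQuot (arrow ℚ (show a ⟶ b from f)) := by
  rw [equivPathQuot, AlgEquiv.symm_apply_eq]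
  exact (eval_arrow (show a ⟶ b from f)).symm

end CornerA

end CornerPath

/-! ### Fullness of the idempotent `a`, and the Morita equivalence. -/

section CornerMoritaPath

open CategoryTheory

open scoped ModuleCat.Algebra

/-- The term `1 a 1` misses only the last two diagonal entries of the block `A 1 1`; matrix units
move the first diagonal entry there. -/
theorem AlgA.cornerIdem_full : ∃ a b : Fin 3 → AlgA, ∑ i, a i * cornerIdem * b i = 1 := by
  refine ⟨![1, { (0 : AlgA) with x11 := Matrix.single 1 0 1 },
    { (0 : AlgA) with x11 := Matrix.single 2 0 1 }],
    ![1, { (0 : AlgA) with x11 := Matrix.single 0 1 1 },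
    { (0 : AlgA) with x11 := Matrix.single 0 2 1 }], ?_⟩
  rw [Fin.sum_univ_three]
  ext1
  case x11 =>
    ext i j
    fin_cases i <;> fin_cases j <;>
      simp [cornerIdem, a11, a22, a33, a44]
  all_goals simp [cornerIdem, a11, a22, a33, a44]

/-- The corner functor is composed with restriction of scalars along two isomorphisms. The universe
of `B` is left free because the double Burnside algebra, built from isomorphism classes, lives one
universe above `A`. -/
theorem isMoritaEquivalent_of_algEquiv_algA {B : Type w} [Ring B] [Algebra ℚ B]
    (f : B ≃ₐ[ℚ] AlgA) : IsMoritaEquivalent ℚ B Psi.PathQuot := by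
  obtain ⟨a, b, hab⟩ := AlgA.cornerIdem_full
  have := cornerFunctor_isEquivalence.{0, w} AlgA.cornerIdem_isIdempotentElem hab
  let g := CornerA.equivPathQuot.symm
  let F : ModuleCat.{w} B ⥤ ModuleCat.{w} Psi.PathQuot :=
    (ModuleCat.restrictScalarsEquivalenceOfRingEquiv f.symm.toRingEquiv).functor ⋙
      cornerFunctor.{0, w} AlgA.cornerIdem_isIdempotentElem ⋙
      (ModuleCat.restrictScalarsEquivalenceOfRingEquiv g.toRingEquiv).functor
  exact ⟨⟨⟨F.asEquivalence, inferInstanceAs (F.Linear ℚ)⟩⟩⟩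

end CornerMoritaPath

/-! ## Stabilizers in bisets -/

section Stabilizers

namespace FinBiset

variable {G : Type u} [Group G]

/-- The action `(g, h) m = g m h⁻¹` of `G × G` on a biset. -/
instance prodAction (M : FinBiset G) : MulAction (G × G) M where
  smul p m := p.1 • MulOpposite.op p.2⁻¹ • m
  one_smul m := by
    change (1 : G) • MulOpposite.op (1 : G)⁻¹ • m = m
    simp
  mul_smul p q m := by
    change (p.1 * q.1) • MulOpposite.op (p.2 * q.2)⁻¹ • m =
      p.1 • MulOpposite.op p.2⁻¹ • q.1 • MulOpposite.op q.2⁻¹ • m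
    rw [mul_inv_rev, MulOpposite.op_mul, mul_smul, mul_smul, smul_comm q.1]

theorem prod_smul_def {M : FinBiset G} (p : G × G) (m : M) :
    p • m = p.1 • MulOpposite.op p.2⁻¹ • m := rfl

/-- The stabilizer of a point of a biset in `G × G`. -/
abbrev stab {M : FinBiset G} (m : M) : Subgroup (G × G) := MulAction.stabilizer (G × G) m

/-- The conjugate `p K p⁻¹`. -/
abbrev conjBy (p : G × G) (K : Subgroup (G × G)) : Subgroup (G × G) :=
  K.map (MulAut.conj p).toMonoidHom

theorem mem_conjBy {p q : G × G} {K : Subgroup (G × G)} :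
    q ∈ conjBy p K ↔ p⁻¹ * q * p ∈ K := by
  rw [Subgroup.mem_map]
  constructor
  · rintro ⟨x, hx, rfl⟩
    simpa [mul_assoc] using hx
  · intro h
    exact ⟨_, h, by simp [mul_assoc]⟩

theorem stab_smul {M : FinBiset G} (p : G × G) (m : M) : stab (p • m) = conjBy p (stab m) :=
  MulAction.stabilizer_smul_eq_stabilizer_map_conj p m

/-- The composition of subgroups of `G × G`, considered as relations on `G`. -/
def relComp (K L : Subgroup (G × G)) : Subgroup (G × G) where
  carrier := {p | ∃ b, (p.1, b) ∈ K ∧ (b, p.2) ∈ L}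
  mul_mem' := by
    rintro p q ⟨b, h1, h2⟩ ⟨c, k1, k2⟩
    exact ⟨b * c, K.mul_mem h1 k1, L.mul_mem h2 k2⟩
  one_mem' := ⟨1, K.one_mem, L.one_mem⟩
  inv_mem' := by
    rintro p ⟨b, h1, h2⟩
    exact ⟨b⁻¹, K.inv_mem h1, L.inv_mem h2⟩

theorem mem_relComp {K L : Subgroup (G × G)} {p : G × G} :
    p ∈ relComp K L ↔ ∃ b, (p.1, b) ∈ K ∧ (b, p.2) ∈ L := Iff.rfl

/-- The number of `b` with `(1, b) ∈ K` and `(b, 1) ∈ L`. -/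
noncomputable def overlap (K L : Subgroup (G × G)) : ℕ :=
  Nat.card {b : G // (1, b) ∈ K ∧ (b, 1) ∈ L}

/-- The class of a pair, as a point of the biset `M ×_G N`. -/
def tensorMk {M N : FinBiset G} (m : M) (n : N) : tensor M N := tmk m n

/-- The pair `(a, c)` fixes the class of `(m, n)` exactly when some `b` satisfies `a m b⁻¹ = m` and
`b n c⁻¹ = n`. -/
theorem stab_tensorMk {M N : FinBiset G} (m : M) (n : N) :
    stab (tensorMk m n) = relComp (stab m) (stab n) := by
  ext ⟨a, c⟩
  rw [mem_relComp, MulAction.mem_stabilizer_iff]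
  change tmk (a • m) (MulOpposite.op c⁻¹ • n) = tmk m n ↔ _
  rw [tmk_eq_iff]
  refine exists_congr fun b => and_congr ?_ ?_ <;> rw [MulAction.mem_stabilizer_iff, prod_smul_def]
  rw [← smul_comm a]

/-- The sum of the values of a function at the stabilizers of the points of a biset. -/
noncomputable def stabSum {V : Type v} [AddCommMonoid V] (Φ : Subgroup (G × G) → V)
    (M : FinBiset G) : V := ∑ᶠ m : M, Φ (stab m)

section stabSum

variable {V : Type v} [AddCommMonoid V] (Φ : Subgroup (G × G) → V)

theorem stabSum_eq (M : FinBiset G) [Fintype M] : stabSum Φ M = ∑ m : M, Φ (stab m) :=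
  finsum_eq_sum_of_fintype _

theorem stab_equiv {M N : FinBiset G} (e : M ≃ N) (hl : ∀ (g : G) (x : M), e (g • x) = g • e x)
    (hr : ∀ (g : Gᵐᵒᵖ) (x : M), e (g • x) = g • e x) (m : M) : stab (e m) = stab m := by
  ext p
  rw [MulAction.mem_stabilizer_iff, MulAction.mem_stabilizer_iff, prod_smul_def, prod_smul_def,
    ← hr, ← hl, e.apply_eq_iff_eq]

theorem stabSum_congr {M N : FinBiset G} (h : Iso M N) : stabSum Φ M = stabSum Φ N := by
  obtain ⟨e, hl, hr⟩ := h
  have := Fintype.ofFinite M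
  have := Fintype.ofFinite N
  rw [stabSum_eq, stabSum_eq]
  exact Fintype.sum_equiv e _ _ fun m => by rw [stab_equiv e hl hr]

theorem stabSum_disjUnion (M N : FinBiset G) :
    stabSum Φ (disjUnion M N) = stabSum Φ M + stabSum Φ N := by
  have := Fintype.ofFinite M
  have := Fintype.ofFinite N
  let _ : Fintype (disjUnion M N) := inferInstanceAs (Fintype (M ⊕ N))
  rw [stabSum_eq, stabSum_eq, stabSum_eq]
  refine (Fintype.sum_sum_type (α₁ := M) (α₂ := N)
    fun m : disjUnion M N => Φ (stab m)).trans (congrArg₂ _ ?_ ?_) <;>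
    refine Finset.sum_congr rfl fun m _ => congrArg Φ (Subgroup.ext fun p => ?_)
  · exact Sum.inl_injective.eq_iff
  · exact Sum.inr_injective.eq_iff

/-- Summation over the orbits of a finite group. -/
theorem card_nsmul_sum_orbits [Fintype G] {X Z : Type*} [Fintype X] [Fintype Z]
    (act : G → X → X) (act_mul : ∀ g h x, act (g * h) x = act g (act h x))
    (q : X → Z) (hq : Function.Surjective q)
    (hact : ∀ x y, q x = q y ↔ ∃ g, act g x = y) (Ψ : Z → V) :
    Fintype.card G • ∑ z, Ψ z = ∑ x, Nat.card {g : G // act g x = x} • Ψ (q x) := by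
  classical
  rw [← Finset.sum_fiberwise Finset.univ q, Finset.smul_sum]
  refine Finset.sum_congr rfl fun z _ => ?_
  obtain ⟨x₀, rfl⟩ := hq z
  -- For `x = k x₀`, right multiplication by `k` maps the stabilizer of `x` onto the set of `g` with
  -- `g x₀ = x`. These sets partition `G` as `x` runs through the orbit.
  rw [Finset.sum_congr rfl (g := fun x => Nat.card {g : G // act g x₀ = x} • Ψ (q x₀)),
    ← Finset.sum_smul]
  · congr 1
    rw [← Finset.card_univ, Finset.card_eq_sum_card_fiberwise (f := fun g => act g x₀)
      (t := Finset.univ.filter fun x => q x = q x₀)]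
    · exact Finset.sum_congr rfl fun x _ => by rw [Nat.card_eq_fintype_card, Fintype.card_subtype]
    · intro g _
      simpa using ((hact _ _).2 ⟨g, rfl⟩).symm
  · intro x hx
    rw [Finset.mem_filter] at hx
    obtain ⟨k, rfl⟩ := (hact _ _).1 hx.2.symm
    rw [hx.2]
    congr 1
    refine Nat.card_congr ((Equiv.mulRight k).subtypeEquiv fun g => ?_)
    rw [Equiv.coe_mulRight, act_mul]

/-- The points of `M ×_G N` are the `G`-orbits on `M × N`, and `overlap` is the order of the
stabilizer of `(m, n)` in `G`; so this is weighted orbit counting. -/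
theorem card_nsmul_stabSum_tensor [Fintype G] (M N : FinBiset G) [Fintype M] [Fintype N] :
    Fintype.card G • stabSum Φ (tensor M N) =
      ∑ m : M, ∑ n : N, overlap (stab m) (stab n) • Φ (relComp (stab m) (stab n)) := by
  have := Fintype.ofFinite (tensor M N)
  rw [stabSum_eq, card_nsmul_sum_orbits (X := M × N) (Z := tensor M N)
    (fun g x => (MulOpposite.op g⁻¹ • x.1, g • x.2)) (fun g h x => by simp [mul_smul])
    (fun x => tensorMk x.1 x.2) (fun z => by
      obtain ⟨m, n, rfl⟩ := tmk_surj z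
      exact ⟨(m, n), rfl⟩)
    (fun x y => by
      refine tmk_eq_iff.trans (exists_congr fun g => ?_)
      rw [Prod.ext_iff]), Fintype.sum_prod_type]
  refine Finset.sum_congr rfl fun m _ => Finset.sum_congr rfl fun n _ => ?_
  rw [stab_tensorMk]
  congr 1
  refine Nat.card_congr (Equiv.subtypeEquivRight fun g => ?_)
  simp [Prod.ext_iff, MulAction.mem_stabilizer_iff, prod_smul_def]

end stabSum

variable {A : Type v} [Ring A] {Φ : Subgroup (G × G) → A}

/-- Translating `m` by `(1, g)` permutes `M`, so the double sum may be averaged over `g`, which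
conjugates the stabilizer of `m`. It is therefore enough that `Φ` be multiplicative in this averaged
sense. The factor `|G|²` cancels because `A` is a rational vector space. -/
theorem stabSum_tensor [Algebra ℚ A] [Fintype G]
    (h : ∀ K L : Subgroup (G × G), ∑ g : G, overlap (conjBy (1, g) K) L •
      Φ (relComp (conjBy (1, g) K) L) = Fintype.card G ^ 2 • (Φ K * Φ L)) (M N : FinBiset G) :
    stabSum Φ (tensor M N) = stabSum Φ M * stabSum Φ N := by
  have := Fintype.ofFinite M
  have := Fintype.ofFinite N
  have key : Fintype.card G ^ 2 • stabSum Φ (tensor M N) =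
      Fintype.card G ^ 2 • (stabSum Φ M * stabSum Φ N) := by
    calc Fintype.card G ^ 2 • stabSum Φ (tensor M N)
        = ∑ _g : G, ∑ m : M, ∑ n : N, overlap (stab m) (stab n) •
            Φ (relComp (stab m) (stab n)) := by
          rw [pow_two, mul_smul, card_nsmul_stabSum_tensor, Finset.sum_const, Finset.card_univ]
      _ = ∑ g : G, ∑ m : M, ∑ n : N, overlap (conjBy (1, g) (stab m)) (stab n) •
            Φ (relComp (conjBy (1, g) (stab m)) (stab n)) := by
          refine Finset.sum_congr rfl fun g _ => ?_
          refine (Fintype.sum_equiv (MulAction.toPerm ((1, g) : G × G)) _ _ fun m => ?_).symm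
          rw [MulAction.toPerm_apply, stab_smul]
      _ = ∑ m : M, ∑ n : N, Fintype.card G ^ 2 • (Φ (stab m) * Φ (stab n)) := by
          rw [Finset.sum_comm]
          refine Finset.sum_congr rfl fun m _ => ?_
          rw [Finset.sum_comm]
          exact Finset.sum_congr rfl fun n _ => h _ _
      _ = _ := by
          rw [stabSum_eq, stabSum_eq, Finset.sum_mul_sum, Finset.smul_sum]
          exact Finset.sum_congr rfl fun m _ => Finset.smul_sum.symm
  rw [← Nat.cast_smul_eq_nsmul ℚ, ← Nat.cast_smul_eq_nsmul ℚ] at key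
  exact smul_right_injective A (by simp : ((Fintype.card G ^ 2 : ℕ) : ℚ) ≠ 0) key

/-- An element of `G`, as a point of the regular biset. -/
def regularMk [Finite G] (g : G) : regular G := g

theorem prod_smul_regularMk [Finite G] (p : G × G) (g : G) :
    p • regularMk g = regularMk (p.1 * g * p.2⁻¹) := (mul_assoc p.1 g p.2⁻¹).symm

theorem regularMk_injective [Finite G] : Function.Injective (regularMk (G := G)) := fun _ _ h => h

theorem stab_regularMk_one [Finite G] :
    stab (regularMk (1 : G)) = (MonoidHom.prod (MonoidHom.id G) (MonoidHom.id G)).range := by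
  ext ⟨a, b⟩
  rw [MulAction.mem_stabilizer_iff, prod_smul_regularMk, regularMk_injective.eq_iff, mul_one,
    mul_inv_eq_one, MonoidHom.mem_range]
  simp [Prod.ext_iff]

/-- The regular biset is transitive, so all its stabilizers are conjugate to that of `1`, the
diagonal. -/
theorem stabSum_regular [Fintype G] (hconj : ∀ p K, Φ (conjBy p K) = Φ K) :
    stabSum Φ (regular G) = Fintype.card G •
      Φ (MonoidHom.prod (MonoidHom.id G) (MonoidHom.id G)).range := by
  let _ : Fintype (regular G) := inferInstanceAs (Fintype G)
  have h : ∀ g : regular G, Φ (stab g) = Φ (stab (regularMk (1 : G))) := fun g => by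
    have hg : g = ((id g, 1) : G × G) • regularMk (1 : G) := by
      rw [prod_smul_regularMk, mul_one, inv_one, mul_one]
      rfl
    rw [hg, stab_smul, hconj]
  rw [stabSum_eq, ← stab_regularMk_one, Finset.sum_congr rfl fun g _ => h g, Finset.sum_const]
  rfl

/-- The transitive biset `(G × G) / K`. -/
def coset [Finite G] (K : Subgroup (G × G)) : FinBiset G where
  carrier := (G × G) ⧸ K
  left := MulAction.compHom _ (MonoidHom.inl G G)
  right :=
    { smul := fun g x => ((1, g.unop⁻¹) : G × G) • x
      one_smul := fun x => by
        change ((1, (1 : G)⁻¹) : G × G) • x = x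
        rw [inv_one, Prod.mk_one_one, one_smul]
      mul_smul := fun g h x => by
        change ((1, (h.unop * g.unop)⁻¹) : G × G) • x =
          ((1, g.unop⁻¹) : G × G) • ((1, h.unop⁻¹) : G × G) • x
        rw [← mul_smul, Prod.mk_mul_mk, one_mul, mul_inv_rev] }
  comm := @SMulCommClass.mk _ _ _ (_) (_) fun g h x => by
    change ((g, 1) : G × G) • ((1, h.unop⁻¹) : G × G) • (x : (G × G) ⧸ K) =
      ((1, h.unop⁻¹) : G × G) • ((g, 1) : G × G) • (x : (G × G) ⧸ K)
    rw [← mul_smul, ← mul_smul, Prod.mk_mul_mk, Prod.mk_mul_mk, mul_one, one_mul, one_mul,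
      mul_one]

/-- A coset, as a point of the transitive biset. -/
def cosetMk [Finite G] (K : Subgroup (G × G)) (p : G × G) : coset K := (p : (G × G) ⧸ K)

theorem cosetMk_surjective [Finite G] (K : Subgroup (G × G)) :
    Function.Surjective (cosetMk K) := QuotientGroup.mk_surjective

theorem cosetMk_eq_iff [Finite G] {K : Subgroup (G × G)} {p q : G × G} :
    cosetMk K p = cosetMk K q ↔ p⁻¹ * q ∈ K := QuotientGroup.eq

theorem smul_cosetMk [Finite G] (K : Subgroup (G × G)) (p q : G × G) :
    p • cosetMk K q = cosetMk K (p * q) := by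
  change cosetMk K ((p.1, 1) * ((1, p.2⁻¹⁻¹) * q)) = _
  rw [← mul_assoc, show ((p.1, 1) * (1, p.2⁻¹⁻¹) : G × G) = p by simp]

theorem stab_cosetMk [Finite G] (K : Subgroup (G × G)) (p : G × G) :
    stab (cosetMk K p) = conjBy p K := by
  ext q
  rw [MulAction.mem_stabilizer_iff, mem_conjBy, smul_cosetMk, eq_comm, cosetMk_eq_iff, mul_assoc]

theorem stabSum_coset [Finite G] (hconj : ∀ p K, Φ (conjBy p K) = Φ K) (K : Subgroup (G × G)) :
    stabSum Φ (coset K) = K.index • Φ K := by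
  have := Fintype.ofFinite (coset K)
  rw [stabSum_eq]
  have h : ∀ x : coset K, Φ (stab x) = Φ K := fun x => by
    obtain ⟨p, rfl⟩ := cosetMk_surjective K x
    rw [stab_cosetMk, hconj]
  rw [Finset.sum_congr rfl fun x _ => h x, Finset.sum_const, Finset.card_univ,
    ← Nat.card_eq_fintype_card]
  rfl

end FinBiset

end Stabilizers

/-! ## Spanning sets of the double Burnside algebra and homomorphisms out of it -/

section BurnsideHom

namespace FinBiset

variable {G : Type u} [Group G]

theorem Iso.of_bijective {M N : FinBiset G} (f : M → N) (hf : Function.Bijective f)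
    (h : ∀ (p : G × G) (x : M), f (p • x) = p • f x) : Iso M N := by
  refine ⟨Equiv.ofBijective f hf, fun g x => ?_, fun g x => ?_⟩
  · have k := h (g, 1) x
    simpa [prod_smul_def] using k
  · have k := h (1, g.unop⁻¹) x
    simpa [prod_smul_def] using k

theorem smul_mem_orbit_iff {M : FinBiset G} (p : G × G) (x m : M) :
    p • x ∈ MulAction.orbit (G × G) m ↔ x ∈ MulAction.orbit (G × G) m := by
  rw [← MulAction.orbit_eq_iff, ← MulAction.orbit_eq_iff, MulAction.orbit_smul]

/-- The complement of the orbit of a point. -/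
def orbitCompl {M : FinBiset G} (m : M) : FinBiset G where
  carrier := {x : M // x ∉ MulAction.orbit (G × G) m}
  left :=
    { smul := fun g x => ⟨g • x.1, fun h => x.2 (by
        have k : g • x.1 = ((g, 1) : G × G) • x.1 := by simp [prod_smul_def]
        rw [k] at h
        exact (smul_mem_orbit_iff _ _ _).1 h)⟩
      one_smul := fun x => Subtype.ext (one_smul G x.1)
      mul_smul := fun g h x => Subtype.ext (mul_smul g h x.1) }
  right :=
    { smul := fun g x => ⟨g • x.1, fun h => x.2 (by
        have k : g • x.1 = ((1, g.unop⁻¹) : G × G) • x.1 := by simp [prod_smul_def]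
        rw [k] at h
        exact (smul_mem_orbit_iff _ _ _).1 h)⟩
      one_smul := fun x => Subtype.ext (one_smul Gᵐᵒᵖ x.1)
      mul_smul := fun g h x => Subtype.ext (mul_smul g h x.1) }
  comm := @SMulCommClass.mk _ _ _ (_) (_) fun g h x => Subtype.ext (smul_comm g h x.1)

/-- The inclusion of the complement of an orbit. -/
def orbitComplVal {M : FinBiset G} {m : M} (x : orbitCompl m) : M := Subtype.val x

/-- The orbit-stabilizer bijection identifies the orbit of `m` with a coset space. Splitting off one
orbit is the induction step of `span_coset`. -/
theorem iso_disjUnion_orbitCompl [Finite G] {M : FinBiset G} (m : M) :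
    Iso (disjUnion (coset (stab m)) (orbitCompl m)) M := by
  refine Iso.of_bijective
    (fun x : coset (stab m) ⊕ orbitCompl m =>
      Sum.elim (MulAction.ofQuotientStabilizer (G × G) m) orbitComplVal x) ⟨?_, fun x => ?_⟩ ?_
  · rintro (x | x) (y | y) h
    · exact congrArg Sum.inl (MulAction.injective_ofQuotientStabilizer (G × G) m h)
    · refine absurd ?_ y.2
      obtain ⟨p, rfl⟩ := cosetMk_surjective _ x
      exact ⟨p, h⟩
    · refine absurd ?_ x.2
      obtain ⟨p, rfl⟩ := cosetMk_surjective _ y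
      exact ⟨p, h.symm⟩
    · exact congrArg Sum.inr (Subtype.ext h)
  · by_cases hx : x ∈ MulAction.orbit (G × G) m
    · obtain ⟨p, rfl⟩ := hx
      exact ⟨Sum.inl (cosetMk _ p), rfl⟩
    · exact ⟨Sum.inr ⟨x, hx⟩, rfl⟩
  · rintro p (x | x)
    · obtain ⟨q, rfl⟩ := cosetMk_surjective _ x
      change MulAction.ofQuotientStabilizer (G × G) m (p • cosetMk (stab m) q) = p • q • m
      rw [smul_cosetMk]
      exact mul_smul p q m
    · rfl

end FinBiset

namespace DoubleBurnside

open FinBiset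

variable {G : Type u} [Group G] [Finite G]

/-- The class of a biset in the double Burnside algebra. -/
noncomputable def ofBiset (M : FinBiset G) : DoubleBurnside ℚ G :=
  (burnsideIdeal ℚ G).ringCon.mk' (MonoidAlgebra.of ℚ _ (BisetClass.mk M))

theorem ofBiset_congr {M N : FinBiset G} (h : Iso M N) : ofBiset M = ofBiset N :=
  congrArg (fun c => (burnsideIdeal ℚ G).ringCon.mk' (MonoidAlgebra.of ℚ _ c)) (Quotient.sound h)

theorem mem_burnsideIdeal {x : MonoidAlgebra ℚ (BisetClass G)} :
    x ∈ burnsideIdeal ℚ G ↔ x ∈ burnsideRel ℚ G := by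
  rw [burnsideIdeal, TwoSidedIdeal.mem_mk']
  rfl

theorem ofBiset_disjUnion (M N : FinBiset G) :
    ofBiset (disjUnion M N) = ofBiset M + ofBiset N := by
  rw [ofBiset, ofBiset, ofBiset, ← map_add]
  refine (RingCon.eq _).2 ((TwoSidedIdeal.rel_iff _ _ _).2 (mem_burnsideIdeal.2 ?_))
  refine Submodule.subset_span ⟨BisetClass.mk M, BisetClass.mk N, ?_⟩
  rw [BisetClass.mk_add_mk, sub_sub]

theorem span_ofBiset : Submodule.span ℚ (Set.range (ofBiset (G := G))) = ⊤ := by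
  rw [eq_top_iff]
  rintro y -
  obtain ⟨x, rfl⟩ := RingCon.mk'_surjective _ y
  induction x using MonoidAlgebra.induction_on with
  | of c =>
    obtain ⟨M⟩ := c
    exact Submodule.subset_span ⟨M, rfl⟩
  | add x y h k => rw [map_add]; exact Submodule.add_mem _ h k
  | smul r x h => exact Submodule.smul_mem _ r h

/-- By induction on the cardinality a biset is a disjoint union of coset bisets; moving the chosen
point within its orbit replaces the stabilizer by any desired conjugate. -/
theorem span_coset (P : Subgroup (G × G) → Prop) (hP : ∀ K, ∃ p, P (conjBy p K)) :
    Submodule.span ℚ {x | ∃ K, P K ∧ x = ofBiset (coset K)} = ⊤ := by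
  rw [eq_top_iff, ← span_ofBiset, Submodule.span_le]
  rintro _ ⟨M, rfl⟩
  induction hn : Nat.card M using Nat.strong_induction_on generalizing M with
  | _ n ih =>
    subst hn
    rcases isEmpty_or_nonempty M with hM | ⟨⟨m₀⟩⟩
    -- The empty biset is isomorphic to two copies of itself, hence its class is zero.
    · have h : Iso (disjUnion M M) M := by
        have : IsEmpty (disjUnion M M) := inferInstanceAs (IsEmpty (M ⊕ M))
        exact Iso.of_bijective isEmptyElim ⟨fun x => isEmptyElim x, fun x => isEmptyElim x⟩
          fun _ x => isEmptyElim x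
      have k := ofBiset_congr h
      rw [ofBiset_disjUnion, add_eq_left] at k
      rw [k]
      exact Submodule.zero_mem _
    · obtain ⟨p, hp⟩ := hP (stab m₀)
      rw [← stab_smul] at hp
      rw [← ofBiset_congr (iso_disjUnion_orbitCompl (p • m₀)), ofBiset_disjUnion]
      refine Submodule.add_mem _ (Submodule.subset_span ⟨_, hp, rfl⟩) (ih _ ?_ _ rfl)
      exact Finite.card_subtype_lt (x := p • m₀) (by simp)

variable {A : Type v} [Ring A] [Algebra ℚ A] (Φ : Subgroup (G × G) → A)

/-- The monoid homomorphism on the classes of bisets given by `stabSum`. -/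
noncomputable def classHom (h₁ : stabSum Φ (regular G) = 1)
    (h₂ : ∀ M N : FinBiset G, stabSum Φ (tensor M N) = stabSum Φ M * stabSum Φ N) :
    BisetClass G →* A where
  toFun := Quotient.lift (stabSum Φ) fun _ _ h => stabSum_congr Φ h
  map_one' := h₁
  map_mul' := by
    rintro ⟨M⟩ ⟨N⟩
    exact h₂ M N

/-- The homomorphism on the double Burnside algebra given by `stabSum`. -/
noncomputable def stabHom (h₁ : stabSum Φ (regular G) = 1)
    (h₂ : ∀ M N : FinBiset G, stabSum Φ (tensor M N) = stabSum Φ M * stabSum Φ N) :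
    DoubleBurnside ℚ G →ₐ[ℚ] A :=
  (burnsideIdeal ℚ G).ringCon.liftₐ (MonoidAlgebra.lift ℚ A (BisetClass G) (classHom Φ h₁ h₂)) (by
    intro x y hxy
    have h := mem_burnsideIdeal.1 ((TwoSidedIdeal.rel_iff _ _ _).1 hxy)
    have hle : burnsideRel ℚ G ≤
        LinearMap.ker (MonoidAlgebra.lift ℚ A (BisetClass G) (classHom Φ h₁ h₂)).toLinearMap := by
      refine Submodule.span_le.2 ?_
      rintro _ ⟨M, N, rfl⟩
      rw [SetLike.mem_coe, LinearMap.mem_ker, AlgHom.toLinearMap_apply, map_sub, map_sub,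
        MonoidAlgebra.lift_of, MonoidAlgebra.lift_of, MonoidAlgebra.lift_of, sub_sub, sub_eq_zero]
      obtain ⟨M⟩ := M
      obtain ⟨N⟩ := N
      exact stabSum_disjUnion Φ M N
    have k := hle h
    rw [LinearMap.mem_ker, AlgHom.toLinearMap_apply, map_sub, sub_eq_zero] at k
    exact k)

theorem stabHom_ofBiset (h₁ : stabSum Φ (regular G) = 1)
    (h₂ : ∀ M N : FinBiset G, stabSum Φ (tensor M N) = stabSum Φ M * stabSum Φ N)
    (M : FinBiset G) : stabHom Φ h₁ h₂ (ofBiset M) = stabSum Φ M := by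
  change MonoidAlgebra.lift ℚ A (BisetClass G) (classHom Φ h₁ h₂) (MonoidAlgebra.of ℚ _ _) = _
  rw [MonoidAlgebra.lift_of]
  rfl

end DoubleBurnside

end BurnsideHom

/-! ## Numerical data for the symmetric group on three letters -/

section SymmetricThree

namespace SymThree

/-- The sum of six values. -/
def sumSix {α : Type u} [Add α] (f : ℕ → α) : α := f 0 + f 1 + f 2 + f 3 + f 4 + f 5

/-- Whether one of six values is true. -/
def anySix (f : ℕ → Bool) : Bool := f 0 || f 1 || f 2 || f 3 || f 4 || f 5

/-- The product of two elements of `S₃`, given by their numbers. -/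
def mulIdx (a b : ℕ) : ℕ := (11128003707083744395924230030984 >>> (3 * (6 * a + b))) % 8

/-- The inverse of an element of `S₃`, given by its number. -/
def invIdx (a : ℕ) : ℕ := if a = 1 then 2 else if a = 2 then 1 else a

/-- The conjugate `g b g⁻¹` in `S₃`, in terms of numbers. -/
def conjIdx (g b : ℕ) : ℕ := mulIdx (mulIdx g b) (invIdx g)

/-- The conjugacy class of an element of `S₃`, given by its number. -/
def classIdx (a : ℕ) : ℕ := if a = 0 then 0 else if a < 3 then 1 else 2

/-- Weights of the pairs of conjugacy classes, chosen such that the total weights of the subgroups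
of `S₃ × S₃` from different conjugacy classes are different. -/
def weight (c d : ℕ) : ℕ := [5, 4, 3, 2, 6, 1, 2, 2, 1].getD (3 * c + d) 0

/-- A subset of `S₃ × S₃` is encoded by the number whose binary digit at position `6 a + b` tells
whether the pair of the elements numbered `a` and `b` belongs to it. -/
def bit (r a b : ℕ) : Bool := r.testBit (6 * a + b)

/-- The numbers `overlap` for a conjugate of the first subset and for the second subset. -/
def overlapIdx (r s g : ℕ) : ℕ :=
  sumSix fun b => if bit r 0 b && bit s (conjIdx g b) 0 then 1 else 0

/-- The total weight of the composition of a conjugate of the first subset with the second. -/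
def compWeight (r s g : ℕ) : ℕ :=
  sumSix fun a => sumSix fun c =>
    if anySix fun b => bit r a b && bit s (conjIdx g b) c then weight (classIdx a) (classIdx c)
    else 0

/-- The total weight of a subset. -/
def totalWeight (r : ℕ) : ℕ :=
  sumSix fun a => sumSix fun b =>
    if bit r a b then weight (classIdx a) (classIdx b) else 0

/-- Representatives of the conjugacy classes of subgroups of `S₃ × S₃`. -/
def codes : List ℕ :=
  [1, 9, 262145, 2097153, 7, 4161, 8449, 2359305, 63, 37449, 1835015, 14680071, 1090785345,
   8726253633, 8866767105, 29127, 16515135, 9817068105, 262143, 7635497415, 61083775431,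
   68719476735]

/-- The images of the transitive bisets `(S₃ × S₃) / K` in the algebra `A`, in coordinates,
multiplied by the order of `K` and listed by the total weights of the subgroups `K`. -/
def table : List (ℕ × List ℤ) :=
  [(5, [6, 3, 0, 0, 0, 0, 2, 1, 0, 0, 0, 0, 0, 0, 0, 0, 0, 0, 0, 0, 0, 0]),
   (8, [6, 0, 0, 0, 0, 0, 2, 0, 0, 0, 0, 0, 0, 0, 0, 0, 0, 0, 0, 0, 0, 0]),
   (7, [8, 4, 0, -4, -2, 0, 2, 1, 0, 0, 0, 0, 0, 0, 0, -2, -1, 0, 0, 0, 0, 0]),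
   (6, [6, 2, 0, 0, 2, 0, 2, 1, 0, 0, 0, 0, 2, 0, 0, 0, 1, 0, -2, 0, 0, 0]),
   (13, [18, 9, -36, 0, 0, 0, 6, 3, -12, 0, 0, 0, 0, 0, 0, 0, 0, 0, 0, 0, 0, 0]),
   (9, [6, 3, 0, 0, 0, 0, 0, 0, 0, 0, 0, 0, 0, 0, 0, 0, 0, 0, 0, 0, 0, 0]),
   (17, [6, 3, 0, 0, 0, 0, 0, 0, 6, 0, 0, 0, 0, 0, 6, 0, 0, 0, 0, 0, 0, 0]),
   (11, [8, 0, 0, -4, 0, 0, 2, 0, 0, 0, 0, 0, 0, 0, 0, -2, 0, 0, 0, 0, 0, 0]),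
   (22, [18, 0, -36, 0, 0, 0, 6, 0, -12, 9, 0, 3, 0, 0, 0, 0, 0, 0, 0, 0, 0, 0]),
   (14, [6, 0, 0, 0, 0, 0, 0, 0, 0, 0, 0, 0, 0, 0, 0, 0, 0, 0, 0, 0, 0, 0]),
   (19, [24, 12, -48, -12, -6, 24, 6, 3, -12, 0, 0, 0, 0, 0, 0, -6, -3, 12, 0, 0, 0, 0]),
   (16, [18, 6, -36, 0, 6, 0, 6, 3, -12, 3, -6, 0, 6, 6, 0, 0, 3, 0, -6, 0, 69, -6]),
   (15, [12, 6, 0, -12, -6, 0, 0, 0, 0, 0, 0, 0, 0, 0, 0, 0, 0, 0, 0, 0, 0, 0]),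
   (12, [6, 0, 0, 0, 6, 0, 0, 0, 0, 0, 0, 0, 6, 0, 0, 0, 0, 0, 0, 0, 0, 0]),
   (20, [6, 0, 0, 0, 6, 0, 0, 0, 6, 0, 0, 0, 6, 0, 6, 0, 0, 0, 0, 6, 0, 0]),
   (41, [18, 9, -36, 0, 0, 0, 0, 0, 0, 0, 0, 0, 0, 0, 0, 0, 0, 0, 0, 0, 0, 0]),
   (31, [24, 0, -48, -12, 0, 24, 6, 0, -12, 12, -6, 3, 0, 0, 0, -6, 0, 12, 0, 0, -3, 0]),
   (23, [12, 0, 0, -12, 0, 0, 0, 0, 0, 0, 0, 0, 0, 0, 0, 0, 0, 0, 0, 0, 0, 0]),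
   (56, [18, 0, -36, 0, 0, 0, 0, 0, 0, 9, 0, 0, 0, 0, 0, 0, 0, 0, 0, 0, 0, 0]),
   (59, [36, 18, -72, -36, -18, 72, 0, 0, 0, 0, 0, 0, 0, 0, 0, 0, 0, 0, 0, 0, 0, 0]),
   (50, [18, 0, -36, 0, 18, 0, 0, 0, 0, 9, -18, 0, 18, 18, 0, 0, 0, 0, 0, 0, 0, 0]),
   (83, [36, 0, -72, -36, 0, 72, 0, 0, 0, 18, -18, 0, 0, 0, 0, 0, 0, 0, 0, 0, 0, 0])]

/-- The row of the table that belongs to a total weight. -/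
def row (h : ℕ) : ℕ → ℤ := fun i => ((table.lookup h).getD []).getD i 0

/-- The multiplication of `A` in coordinates. -/
def mulCoord (x y : ℕ → ℤ) : ℕ → ℤ := fun i =>
   [x 0 * y 0 + x 1 * y 3 + x 2 * y 6,
    x 0 * y 1 + x 1 * y 4 + x 2 * y 7,
    x 0 * y 2 + x 1 * y 5 + x 2 * y 8,
    x 3 * y 0 + x 4 * y 3 + x 5 * y 6,
    x 3 * y 1 + x 4 * y 4 + x 5 * y 7,
    x 3 * y 2 + x 4 * y 5 + x 5 * y 8,
    x 6 * y 0 + x 7 * y 3 + x 8 * y 6,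
    x 6 * y 1 + x 7 * y 4 + x 8 * y 7,
    x 6 * y 2 + x 7 * y 5 + x 8 * y 8,
    x 0 * y 9 + x 1 * y 10 + x 2 * y 11 + y 19 * x 9,
    x 3 * y 9 + x 4 * y 10 + x 5 * y 11 + y 19 * x 10,
    x 6 * y 9 + x 7 * y 10 + x 8 * y 11 + y 19 * x 11,
    x 12 * y 12,
    x 12 * y 13 + x 13 * y 19,
    x 14 * y 14,
    x 15 * y 0 + x 16 * y 3 + x 17 * y 6 + x 19 * y 15,
    x 15 * y 1 + x 16 * y 4 + x 17 * y 7 + x 19 * y 16,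
    x 15 * y 2 + x 16 * y 5 + x 17 * y 8 + x 19 * y 17,
    x 18 * y 12 + x 19 * y 18,
    x 19 * y 19,
    -- The coefficient of `η`; the term with `-12` comes from the product `A 4 2 × A 2 4`, which
    -- takes values in the multiples of `ξ - 12 η`.
    x 15 * y 9 + x 16 * y 10 + x 17 * y 11 - 12 * (x 18 * y 13) + x 19 * y 20 + x 20 * y 19,
    x 18 * y 13 + x 19 * y 21 + x 21 * y 19].getD i 0

/-- This is the hypothesis of `stabSum_tensor` on the representatives, for `Φ = row / 36`: the
denominators cancel against `|S₃|² = 36`, so an identity of integers remains. The class of each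
composite is recognized by its total weight. -/
theorem table_mul : (codes.all fun r => codes.all fun s => (List.range 22).all fun i =>
    (sumSix fun g => (overlapIdx r s g : ℤ) * row (compWeight r s g) i) ==
      mulCoord (row (totalWeight r)) (row (totalWeight s)) i) = true := by
  decide +kernel

end SymThree

end SymmetricThree

/-! ### Exhaustive search for the subgroups of `S₃ × S₃`. -/

section SymmetricThree

namespace SymThree

open Equiv

/-- The product in `S₃ × S₃`, where the pair of the elements numbered `a` and `b` has the number
`6 a + b`. -/
def mulPair (k l : ℕ) : ℕ := 6 * mulIdx (k / 6) (l / 6) + mulIdx (k % 6) (l % 6)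

/-- The conjugate `g k g⁻¹` in `S₃ × S₃`, in terms of numbers. -/
def conjPair (g k : ℕ) : ℕ := 6 * conjIdx (g / 6) (k / 6) + conjIdx (g % 6) (k % 6)

/-- Adjoin the products `l k` for `l` in a subset. -/
def adjoinMul (X k : ℕ) (Y : ℕ) : ℕ :=
  (List.range 36).foldl (fun m l => bif X.testBit l then m ||| 1 <<< mulPair l k else m) Y

/-- Adjoin all products of two elements of a subset. -/
def adjoinSq (X : ℕ) : ℕ :=
  (List.range 36).foldl (fun m k => bif X.testBit k then adjoinMul X k m else m) X

/-- Whether a subset is conjugate to one of the chosen representatives. -/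
def isConjCode (X : ℕ) : Bool :=
  codes.any fun r => totalWeight X == totalWeight r &&
    (List.range 36).any fun g => (List.range 36).all fun k => r.testBit k == X.testBit (conjPair g k)

/-- Decide one after the other whether the elements with numbers `k`, `k + 1`, ... belong to a
subgroup, where `X` is a set of elements known to belong to it and `E` is a set of elements known
not to belong to it. The result is true if all subgroups obtained in this way are conjugate to one
of the representatives. -/
def search : ℕ → ℕ → ℕ → ℕ → Bool
  | 0, _, X, _ => isConjCode X
  | n + 1, k, X, E =>
    bif X.testBit k then search n (k + 1) X E else
      search n (k + 1) X (E ||| 1 <<< k) &&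
        -- The cheap products `l k` are tested first; a common digit with the excluded set `E` ends
        -- the branch before any squaring. The squarings need not reach the generated subgroup for
        -- soundness: they add only elements that are forced.
        (bif adjoinMul X k (X ||| 1 <<< k) &&& E == 0 then
          (bif adjoinSq (adjoinSq (adjoinMul X k (X ||| 1 <<< k))) &&& E == 0 then
            search n (k + 1) (adjoinSq (adjoinSq (adjoinMul X k (X ||| 1 <<< k)))) E
          else true)
        else true)

/-- The initial set `1` has only the digit of the identity, and nothing is excluded. -/
theorem search_eq_true : search 36 0 1 0 = true := by
  decide +kernel

end SymThree

end SymmetricThree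

/-! ### Conjugation invariance, and soundness of the computations with numbers. -/

section SymmetricThree

namespace FinBiset

variable {G : Type u} [Group G]

/-- Replacing the middle element `b` by `z⁻¹ b z` moves both inner conjugations to the first
relation; the outer ones conjugate the composite. -/
theorem relComp_conjBy (x y z w : G) (K L : Subgroup (G × G)) :
    relComp (conjBy (x, y) K) (conjBy (z, w) L) =
      conjBy (x, w) (relComp (conjBy (1, z⁻¹ * y) K) L) := by
  ext ⟨a, c⟩
  simp only [mem_relComp, mem_conjBy, Prod.inv_mk, Prod.mk_mul_mk, inv_one, one_mul, mul_one]
  refine ((MulAut.conj z).symm.toEquiv.exists_congr fun b => ?_)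
  simp [mul_assoc]

theorem overlap_conjBy (x y z w : G) (K L : Subgroup (G × G)) :
    overlap (conjBy (x, y) K) (conjBy (z, w) L) = overlap (conjBy (1, z⁻¹ * y) K) L := by
  refine Nat.card_congr ((MulAut.conj z).symm.toEquiv.subtypeEquiv fun b => ?_)
  simp only [mem_conjBy, Prod.inv_mk, Prod.mk_mul_mk, inv_one, mul_one, inv_mul_cancel]
  simp [mul_assoc]

/-- The left-hand side of the condition for multiplicativity of `stabSum` is invariant under
conjugation. -/
theorem sum_overlap_conjBy [Fintype G] {V : Type v} [AddCommMonoid V] {Φ : Subgroup (G × G) → V}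
    (hconj : ∀ p K, Φ (conjBy p K) = Φ K) (p q : G × G) (K L : Subgroup (G × G)) :
    ∑ g : G, overlap (conjBy (1, g) (conjBy p K)) (conjBy q L) •
        Φ (relComp (conjBy (1, g) (conjBy p K)) (conjBy q L)) =
      ∑ g : G, overlap (conjBy (1, g) K) L • Φ (relComp (conjBy (1, g) K) L) := by
  have h : ∀ g : G, conjBy (1, g) (conjBy p K) = conjBy (p.1, g * p.2) K := fun g => by
    ext x
    simp only [mem_conjBy]
    rw [show ((p.1, g * p.2) : G × G) = (1, g) * p by ext <;> simp]
    simp only [mul_inv_rev, mul_assoc]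
  -- The inner conjugations by `p.2` and `q.1` turn `g` into `q.1⁻¹ g p.2`, which again runs through
  -- `G`.
  refine Fintype.sum_equiv ((Equiv.mulLeft q.1⁻¹).trans (Equiv.mulRight p.2)) _ _ fun g => ?_
  rw [h, ← Prod.mk.eta (p := q), overlap_conjBy, relComp_conjBy, hconj]
  simp only [Equiv.trans_apply, Equiv.coe_mulLeft, Equiv.coe_mulRight, mul_assoc]

end FinBiset

namespace SymThree

open Equiv FinBiset

/-- The elements of `S₃` in a fixed order. -/
def perm : ℕ → Perm (Fin 3)
  | 0 => 1
  | 1 => finRotate 3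
  | 2 => finRotate 3 ^ 2
  | 3 => swap 0 1
  | 4 => swap 1 2
  | _ => swap 0 2

theorem perm_bijective : Function.Bijective fun i : Fin 6 => perm i := by
  decide +kernel

/-- The numbering of the elements of `S₃`. -/
noncomputable def permEquiv : Fin 6 ≃ Perm (Fin 3) := Equiv.ofBijective _ perm_bijective

theorem permEquiv_apply (i : Fin 6) : permEquiv i = perm i := rfl

/-- The large constant in `mulIdx` is the packed multiplication table, three binary digits per
entry; it is checked here against permutations. -/
theorem perm_mulIdx (a b : Fin 6) : perm (mulIdx a b) = perm a * perm b := by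
  revert a b
  decide +kernel

theorem mulIdx_lt (a b : Fin 6) : mulIdx a b < 6 := by
  revert a b
  decide +kernel

theorem perm_conjIdx (a b : Fin 6) : perm (conjIdx a b) = perm a * perm b * (perm a)⁻¹ := by
  revert a b
  decide +kernel

theorem conjIdx_lt (a b : Fin 6) : conjIdx a b < 6 := by
  revert a b
  decide +kernel

/-- The element of `S₃ × S₃` with a given number. -/
def pair (k : ℕ) : Perm (Fin 3) × Perm (Fin 3) := (perm (k / 6), perm (k % 6))

theorem pair_add (a b : Fin 6) : pair (6 * a + b) = (perm a, perm b) := by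
  have h1 : (6 * a.1 + b.1) / 6 = a.1 := by omega
  have h2 : (6 * a.1 + b.1) % 6 = b.1 := by omega
  rw [pair, h1, h2]

theorem pair_mulPair {k l : ℕ} (hk : k < 36) (hl : l < 36) :
    pair (mulPair k l) = pair k * pair l := by
  have h1 := perm_mulIdx ⟨k / 6, by omega⟩ ⟨l / 6, by omega⟩
  have h2 := perm_mulIdx ⟨k % 6, by omega⟩ ⟨l % 6, by omega⟩
  have h3 := pair_add ⟨_, mulIdx_lt ⟨k / 6, by omega⟩ ⟨l / 6, by omega⟩⟩
    ⟨_, mulIdx_lt ⟨k % 6, by omega⟩ ⟨l % 6, by omega⟩⟩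
  exact h3.trans (Prod.ext h1 h2)

theorem pair_conjPair {g k : ℕ} (hg : g < 36) (hk : k < 36) :
    pair (conjPair g k) = pair g * pair k * (pair g)⁻¹ := by
  have h1 := perm_conjIdx ⟨g / 6, by omega⟩ ⟨k / 6, by omega⟩
  have h2 := perm_conjIdx ⟨g % 6, by omega⟩ ⟨k % 6, by omega⟩
  have h3 := pair_add ⟨_, conjIdx_lt ⟨g / 6, by omega⟩ ⟨k / 6, by omega⟩⟩
    ⟨_, conjIdx_lt ⟨g % 6, by omega⟩ ⟨k % 6, by omega⟩⟩
  exact h3.trans (Prod.ext h1 h2)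

theorem conjPair_lt {g k : ℕ} (hg : g < 36) (hk : k < 36) : conjPair g k < 36 := by
  have h1 := conjIdx_lt ⟨g / 6, by omega⟩ ⟨k / 6, by omega⟩
  have h2 := conjIdx_lt ⟨g % 6, by omega⟩ ⟨k % 6, by omega⟩
  simp only [conjPair] at *
  omega

/-- The subgroup `K` is encoded by `r`. -/
def HasCode (r : ℕ) (K : Subgroup (Perm (Fin 3) × Perm (Fin 3))) : Prop :=
  ∀ k < 36, pair k ∈ K ↔ r.testBit k = true

theorem HasCode.mem_iff {r : ℕ} {K : Subgroup (Perm (Fin 3) × Perm (Fin 3))} (h : HasCode r K)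
    (a b : Fin 6) : (perm a, perm b) ∈ K ↔ bit r a b = true := by
  rw [← pair_add, h _ (by omega), bit]

theorem HasCode.unique {r : ℕ} {K L : Subgroup (Perm (Fin 3) × Perm (Fin 3))} (h : HasCode r K)
    (k : HasCode r L) : K = L := by
  ext ⟨a, b⟩
  obtain ⟨i, rfl⟩ := permEquiv.surjective a
  obtain ⟨j, rfl⟩ := permEquiv.surjective b
  rw [permEquiv_apply, permEquiv_apply, h.mem_iff, k.mem_iff]

/-! ### Soundness of the search. -/

section Search

variable {S : Subgroup (Perm (Fin 3) × Perm (Fin 3))}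

/-- The digits of `X` belong to elements of `S`. -/
def Inside (S : Subgroup (Perm (Fin 3) × Perm (Fin 3))) (X : ℕ) : Prop :=
  ∀ l < 36, X.testBit l = true → pair l ∈ S

/-- The digits of `E` belong to elements outside of `S`. -/
def Outside (S : Subgroup (Perm (Fin 3) × Perm (Fin 3))) (E : ℕ) : Prop :=
  ∀ l, E.testBit l = true → l < 36 ∧ pair l ∉ S

theorem testBit_or_shiftLeft (X k l : ℕ) :
    (X ||| 1 <<< k).testBit l = true ↔ X.testBit l = true ∨ k = l := by
  rw [Nat.testBit_or, Nat.one_shiftLeft, Nat.testBit_two_pow]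
  simp

theorem Inside.insert {X k : ℕ} (h : Inside S X) (hk : pair k ∈ S) : Inside S (X ||| 1 <<< k) := by
  intro l hl hb
  rcases (testBit_or_shiftLeft _ _ _).1 hb with hb | rfl
  · exact h l hl hb
  · exact hk

theorem Outside.insert {E k : ℕ} (h : Outside S E) (hk : k < 36) (hk' : pair k ∉ S) :
    Outside S (E ||| 1 <<< k) := by
  intro l hb
  rcases (testBit_or_shiftLeft _ _ _).1 hb with hb | rfl
  · exact h l hb
  · exact ⟨hk, hk'⟩

theorem foldl_induction {P : ℕ → Prop} {f : ℕ → ℕ → ℕ} (l : List ℕ)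
    (h : ∀ k ∈ l, ∀ m, P m → P (f m k)) (m : ℕ) (hm : P m) : P (l.foldl f m) := by
  induction l generalizing m with
  | nil => exact hm
  | cons k l ih =>
    exact ih (fun k' hk' => h k' (List.mem_cons_of_mem _ hk')) _ (h k List.mem_cons_self m hm)

theorem testBit_adjoinMul {X k Y l : ℕ} (h : Y.testBit l = true) :
    (adjoinMul X k Y).testBit l = true := by
  refine foldl_induction (P := fun m => m.testBit l = true) _ (fun j _ m hm => ?_) _ h
  cases X.testBit j
  · exact hm
  · exact (testBit_or_shiftLeft _ _ _).2 (Or.inl hm)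

theorem testBit_adjoinSq {X l : ℕ} (h : X.testBit l = true) :
    (adjoinSq X).testBit l = true := by
  refine foldl_induction (P := fun m => m.testBit l = true) _ (fun j _ m hm => ?_) _ h
  cases X.testBit j
  · exact hm
  · exact testBit_adjoinMul hm

theorem Inside.adjoinMul {X k Y : ℕ} (hX : Inside S X) (hk : k < 36) (hk' : pair k ∈ S)
    (hY : Inside S Y) : Inside S (adjoinMul X k Y) := by
  refine foldl_induction _ (fun l hl m hm => ?_) _ hY
  rw [List.mem_range] at hl
  cases hb : X.testBit l
  · simpa using hm
  · refine hm.insert ?_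
    rw [pair_mulPair hl hk]
    exact S.mul_mem (hX l hl hb) hk'

theorem Inside.adjoinSq {X : ℕ} (hX : Inside S X) : Inside S (adjoinSq X) := by
  refine foldl_induction _ (fun k hk m hm => ?_) _ hX
  rw [List.mem_range] at hk
  cases hb : X.testBit k
  · simpa using hm
  · exact hX.adjoinMul hk (hX k hk hb) hm

theorem Inside.land_eq_zero {X E : ℕ} (hX : Inside S X) (hE : Outside S E) : (X &&& E == 0) = true := by
  rw [beq_iff_eq]
  refine Nat.eq_of_testBit_eq fun l => ?_
  rw [Nat.testBit_and, Nat.zero_testBit]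
  by_contra h
  rw [Bool.not_eq_false, Bool.and_eq_true] at h
  exact (hE l h.2).2 (hX l (hE l h.2).1 h.1)

/-- The digits of `r` at `k` and of `X` at `g k g⁻¹` agree, so `r` encodes `g⁻¹ S g`. The comparison
of weights in `isConjCode` only saves time and is discarded. -/
theorem exists_hasCode_of_isConjCode {X : ℕ} (hX : HasCode X S) (h : isConjCode X = true) :
    ∃ p, ∃ r ∈ codes, HasCode r (conjBy p S) := by
  simp only [isConjCode, List.any_eq_true, List.all_eq_true, Bool.and_eq_true, List.mem_range,
    beq_iff_eq] at h
  obtain ⟨r, hr, -, g, hg, h⟩ := h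
  refine ⟨(pair g)⁻¹, r, hr, fun k hk => ?_⟩
  rw [mem_conjBy, inv_inv, ← pair_conjPair hg hk, hX _ (conjPair_lt hg hk), h k hk]

/-- The subgroup `S` selects a path through the search tree. Along it `X` stays inside `S`, `E`
stays outside, and every number below `k` is decided, so that `X` encodes `S` at the leaf. -/
theorem exists_hasCode_of_search (n k X E : ℕ) (hn : k + n = 36) (hX : Inside S X)
    (hE : Outside S E) (hXE : ∀ l < k, X.testBit l = true ∨ E.testBit l = true)
    (h : search n k X E = true) : ∃ p, ∃ r ∈ codes, HasCode r (conjBy p S) := by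
  induction n generalizing k X E with
  | zero =>
    refine exists_hasCode_of_isConjCode (fun l hl => ⟨fun hS => ?_, hX l hl⟩) h
    exact (hXE l (by omega)).resolve_right fun hb => (hE l hb).2 hS
  | succ n ih =>
    rw [search] at h
    have hlt : ∀ l < k + 1, l < k ∨ k = l := fun l hl => by omega
    cases hb : X.testBit k
    · rw [hb, cond_false, Bool.and_eq_true] at h
      -- If `pair k` lies in `S`, so do all adjoined elements. They cannot meet `E`, hence this
      -- branch was not pruned.
      by_cases hk : pair k ∈ S
      · have hX' := hX.insert hk
        have hY := hX.adjoinMul (by omega) hk hX'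
        have hZ := hY.adjoinSq.adjoinSq
        have h2 := h.2
        rw [hY.land_eq_zero hE, hZ.land_eq_zero hE, cond_true, cond_true] at h2
        refine ih (k + 1) _ E (by omega) hZ hE (fun l hl => ?_) h2
        have hmono : (X ||| 1 <<< k).testBit l = true →
            (adjoinSq (adjoinSq (adjoinMul X k (X ||| 1 <<< k)))).testBit l = true :=
          fun hb => testBit_adjoinSq (testBit_adjoinSq (testBit_adjoinMul hb))
        rcases hlt l hl with hl | rfl
        · exact (hXE l hl).imp_left fun hb =>
            hmono ((testBit_or_shiftLeft _ _ _).2 (Or.inl hb))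
        · exact Or.inl (hmono ((testBit_or_shiftLeft _ _ _).2 (Or.inr rfl)))
      · refine ih (k + 1) X _ (by omega) hX (hE.insert (by omega) hk) (fun l hl => ?_) h.1
        rw [testBit_or_shiftLeft, ← or_assoc]
        exact (hlt l hl).imp_left (hXE l)
    · rw [hb, cond_true] at h
      refine ih (k + 1) X E (by omega) hX hE (fun l hl => ?_) h
      rcases hlt l hl with hl | rfl
      · exact hXE l hl
      · exact Or.inl hb

end Search

/-- Every subgroup of `S₃ × S₃` is conjugate to one of the representatives. -/
theorem exists_hasCode (K : Subgroup (Perm (Fin 3) × Perm (Fin 3))) :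
    ∃ p, ∃ r ∈ codes, HasCode r (conjBy p K) := by
  refine exists_hasCode_of_search 36 0 1 0 rfl (fun l _ hb => ?_) (fun l hb => ?_)
    (fun l hl => absurd hl (Nat.not_lt_zero l)) search_eq_true
  · rw [Nat.testBit_one_eq_true_iff_self_eq_zero] at hb
    subst hb
    exact K.one_mem
  · simp at hb

/-! ### Weights of subgroups -/

/-- The conjugacy class of an element of `S₃`. -/
noncomputable def permClass (a : Perm (Fin 3)) : ℕ :=
  if a = 1 then 0 else if Perm.sign a = 1 then 1 else 2

theorem permClass_conj (g a : Perm (Fin 3)) : permClass (g⁻¹ * a * g) = permClass a := by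
  have h1 : g⁻¹ * a * g = 1 ↔ a = 1 := by
    constructor
    · intro h
      rw [mul_assoc, inv_mul_eq_one] at h
      simpa using h.symm
    · rintro rfl
      simp
  have h2 : Perm.sign (g⁻¹ * a * g) = Perm.sign a := by
    rw [Perm.sign_mul, Perm.sign_mul, mul_comm, ← mul_assoc, Perm.sign_inv, Int.units_mul_self,
      one_mul]
  simp only [permClass, h1, h2]

theorem permClass_perm (a : Fin 6) : permClass (perm a) = classIdx a := by
  revert a
  unfold permClass
  decide +kernel

theorem sum_perm {V : Type v} [AddCommMonoid V] (f : Perm (Fin 3) → V) :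
    ∑ a, f a = sumSix fun i => f (perm i) := by
  rw [← permEquiv.sum_comp, Fin.sum_univ_six]
  rfl

theorem anySix_iff (f : ℕ → Bool) : anySix f = true ↔ ∃ i : Fin 6, f i = true := by
  simp [anySix, Fin.exists_fin_succ, or_assoc]

open Classical in
/-- The total weight of a subgroup. -/
noncomputable def subgroupWeight (K : Subgroup (Perm (Fin 3) × Perm (Fin 3))) : ℕ :=
  ∑ a, ∑ b, if (a, b) ∈ K then weight (permClass a) (permClass b) else 0

theorem subgroupWeight_conjBy (p : Perm (Fin 3) × Perm (Fin 3))
    (K : Subgroup (Perm (Fin 3) × Perm (Fin 3))) :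
    subgroupWeight (conjBy p K) = subgroupWeight K := by
  refine Fintype.sum_equiv (MulAut.conj p.1).symm.toEquiv _ _ fun a => ?_
  refine Fintype.sum_equiv (MulAut.conj p.2).symm.toEquiv _ _ fun b => ?_
  have h : ((MulAut.conj p.1).symm.toEquiv a, (MulAut.conj p.2).symm.toEquiv b) =
      p⁻¹ * (a, b) * p := Prod.ext (by simp) (by simp)
  rw [h, ← mem_conjBy]
  congr 2
  · exact (permClass_conj p.1 a).symm
  · exact (permClass_conj p.2 b).symm

/-- Sums of six values agree if the values agree. -/
theorem sumSix_congr {α : Type u} [Add α] {f g : ℕ → α} (h : ∀ i : Fin 6, f i = g i) :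
    sumSix f = sumSix g := by
  have h0 := h 0
  have h1 := h 1
  have h2 := h 2
  have h3 := h 3
  have h4 := h 4
  have h5 := h 5
  simp only [sumSix]
  exact congrArg₂ _ (congrArg₂ _ (congrArg₂ _ (congrArg₂ _ (congrArg₂ _ h0 h1) h2) h3) h4) h5

theorem subgroupWeight_eq_of_mem_iff {K : Subgroup (Perm (Fin 3) × Perm (Fin 3))}
    {f : ℕ → ℕ → Bool} (h : ∀ a b : Fin 6, (perm a, perm b) ∈ K ↔ f a b = true) :
    subgroupWeight K = sumSix fun a => sumSix fun b =>
      if f a b then weight (classIdx a) (classIdx b) else 0 := by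
  rw [subgroupWeight, sum_perm]
  refine sumSix_congr fun a => ?_
  rw [sum_perm]
  refine sumSix_congr fun b => ?_
  rw [permClass_perm, permClass_perm]
  classical
  exact if_congr (h a b) rfl rfl

theorem HasCode.subgroupWeight_eq {r : ℕ} {K : Subgroup (Perm (Fin 3) × Perm (Fin 3))}
    (h : HasCode r K) : subgroupWeight K = totalWeight r :=
  subgroupWeight_eq_of_mem_iff h.mem_iff

/-! ### Compositions and overlaps of encoded subgroups. -/

section Comp

variable {r s : ℕ} {K L : Subgroup (Perm (Fin 3) × Perm (Fin 3))}
  (g : Fin 6)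

/-- The bijection `b ↦ g b g⁻¹` on the numbers of the elements of `S₃`. -/
noncomputable def conjEquiv : Fin 6 ≃ Perm (Fin 3) :=
  permEquiv.trans (MulAut.conj (perm g)).toEquiv

theorem conjEquiv_apply (b : Fin 6) :
    conjEquiv g b = perm g * perm b * (perm g)⁻¹ := rfl

theorem mem_conjBy_iff (hK : HasCode r K) (a b : Fin 6) :
    (perm a, conjEquiv g b) ∈ conjBy (1, perm g) K ↔ bit r a b = true := by
  rw [mem_conjBy, ← hK.mem_iff, conjEquiv_apply]
  simp [mul_assoc]

theorem conjEquiv_mem_iff (hL : HasCode s L) (b c : Fin 6) :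
    (conjEquiv g b, perm c) ∈ L ↔ bit s (conjIdx g b) c = true := by
  rw [conjEquiv_apply, ← perm_conjIdx]
  exact hL.mem_iff ⟨_, conjIdx_lt g b⟩ c

/-- The middle element is written as `g b g⁻¹`: membership in the conjugate of `K` then becomes
membership in `K`, and the conjugation appears only in the index for `L`. -/
theorem subgroupWeight_relComp (hK : HasCode r K) (hL : HasCode s L) :
    subgroupWeight (relComp (conjBy (1, perm g) K) L) = compWeight r s g := by
  refine subgroupWeight_eq_of_mem_iff
    (f := fun a c => anySix fun b => bit r a b && bit s (conjIdx g b) c) fun a c => ?_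
  rw [mem_relComp, anySix_iff]
  refine ((conjEquiv g).exists_congr fun b => ?_).symm
  rw [Bool.and_eq_true, mem_conjBy_iff g hK, conjEquiv_mem_iff g hL]

theorem overlap_eq (hK : HasCode r K) (hL : HasCode s L) :
    overlap (conjBy (1, perm g) K) L = overlapIdx r s g := by
  classical
  rw [overlap, ← Nat.card_congr ((conjEquiv g).subtypeEquiv
    (p := fun b : Fin 6 => (bit r 0 b && bit s (conjIdx g b) 0) = true) fun b => ?_),
    Nat.card_eq_fintype_card, Fintype.card_subtype, Finset.card_filter, Fin.sum_univ_six]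
  · rfl
  · have h1 := mem_conjBy_iff g hK 0 b
    have h2 := conjEquiv_mem_iff g hL b 0
    rw [Bool.and_eq_true]
    exact and_congr h1.symm h2.symm

end Comp

end SymThree

end SymmetricThree

/-! ### Invertibility of the table, and closure of the listed subsets. -/

section SymmetricThree

namespace SymThree

open Equiv FinBiset

/-- Seventy-two times the inverse of the matrix whose rows are the rows of `table`. -/
def invTable : List (List ℤ) :=
  [[0, 0, 0, 0, 0, 0, 0, 0, 0, 12, 0, 0, 0, 0, 0, 0, 0, 0, 0, 0, 0, 0],
   [0, 0, 0, 0, 0, 24, 0, 0, 0, -24, 0, 0, 0, 0, 0, 0, 0, 0, 0, 0, 0, 0],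
   [0, 0, 0, 0, 0, 6, 0, 0, 0, 0, 0, 0, 0, 0, 0, -2, 0, 0, 0, 0, 0, 0],
   [0, 0, 0, 0, 0, 0, 0, 0, 0, 12, 0, 0, 0, 0, 0, 0, 0, -6, 0, 0, 0, 0],
   [0, 0, 0, 0, 0, 24, 0, 0, 0, -24, 0, 0, -12, 0, 0, 0, 0, 12, 0, 0, 0, 0],
   [0, 0, 0, 0, 0, 6, 0, 0, 0, 0, 0, 0, -3, 0, 0, -2, 0, 0, 0, 1, 0, 0],
   [0, 36, 0, 0, 0, 0, 0, 0, 0, -36, 0, 0, 0, 0, 0, 0, 0, 0, 0, 0, 0, 0],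
   [72, -72, 0, 0, 0, -72, 0, 0, 0, 72, 0, 0, 0, 0, 0, 0, 0, 0, 0, 0, 0, 0],
   [18, 0, 0, 0, -6, -18, 0, 0, 0, 0, 0, 0, 0, 0, 0, 6, 0, 0, 0, 0, 0, 0],
   [0, 0, 0, 0, 0, 24, 0, 0, 0, -24, 0, 0, 0, 0, 0, -8, 0, 0, 8, 0, 0, 0],
   [0, 0, 0, 0, 0, 24, 0, 0, 0, -24, 0, 0, -12, 0, 0, -8, 0, 12, 8, 4, 0, -4],
   [72, -72, 0, 0, -24, -72, 0, 0, 24, 72, 0, 0, 0, 0, 0, 24, 0, 0, -24, 0, 0, 0],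
   [0, 0, 0, 0, 0, -24, 0, 0, 0, 12, 0, 0, 12, 12, 0, 0, 0, -12, 0, 0, 0, 0],
   [0, 0, 0, 0, 0, 24, 0, 0, 0, -12, 0, 0, -12, -12, 0, -8, 0, 12, 4, 4, 4, -4],
   [-18, 0, 0, 0, 6, 6, 12, 0, 0, 0, 0, 0, 0, 0, 0, -6, 0, 0, 0, 0, 0, 0],
   [0, 36, 0, 0, 0, 0, 0, -36, 0, -12, 0, 0, 0, 0, 0, 0, 0, 12, 0, 0, 0, 0],
   [72, -72, -72, 0, 0, -24, 0, 72, 0, 24, 0, 0, 24, 0, 0, 0, 0, -24, 0, 0, 0, 0],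
   [18, 0, -18, 0, -6, -6, 0, 0, 0, 0, 6, 0, 6, 0, 0, 2, 0, 0, 0, -2, 0, 0],
   [72, -36, -36, -36, 0, -24, 0, 36, 0, 12, 0, 0, 12, 12, 0, 0, 0, -12, 0, 0, 0, 0],
   [0, 0, 0, 0, 0, 12, -12, 0, 0, 0, 0, 0, 0, -12, 12, 0, 0, 0, 0, 0, 0, 0],
   [72, -72, -72, 0, -24, -24, 0, 72, 24, 24, 24, 0, 24, 0, 0, 8, -24, -24, -8, -8, 0, 8],
   [792, -828, -828, 36, -264, -264, 0, 828, 276, 276, 276, -12, 276, -12, 0, 88, -276, -276, -92, -92, 4, 92]]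

/-- The code of the `i`-th representative. -/
def code (i : Fin 22) : ℕ := codes.getD i 0

/-- The integer certificate that the 22 rows are linearly independent over `ℚ`. -/
theorem table_mul_invTable (i k : Fin 22) :
    ∑ j : Fin 22, row (totalWeight (code i)) j * (invTable.getD j []).getD k 0 =
      if i = k then 72 else 0 := by
  revert i k
  decide +kernel

/-- The inverse in `S₃ × S₃`, in terms of numbers. -/
def invPair (k : ℕ) : ℕ := 6 * invIdx (k / 6) + invIdx (k % 6)

/-- The search shows that the list is exhaustive; this shows that its members are subgroups, so that
each has a transitive biset. -/
theorem codes_closed : (codes.all fun r => r.testBit 0 && (List.range 36).all fun k =>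
    !r.testBit k || (r.testBit (invPair k) && (List.range 36).all fun l =>
      !r.testBit l || r.testBit (mulPair k l))) = true := by
  decide +kernel

end SymThree

end SymmetricThree

/-! ### The isomorphism between the double Burnside algebra of `S₃` and `A`. -/

section SymmetricThree

namespace SymThree

open Equiv FinBiset DoubleBurnside

/-! ### Coordinates on `A` -/

/-- The element of `A` with given integral coordinates. -/
noncomputable def ofCoord (x : ℕ → ℤ) : AlgA where
  x11 := !![(x 0 : ℚ), x 1, x 2; x 3, x 4, x 5; x 6, x 7, x 8]
  x14 := !![(x 9 : ℚ); x 10; x 11]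
  x22 := x 12
  x24 := x 13
  x33 := x 14
  x41 := !![(x 15 : ℚ), x 16, x 17]
  x42 := x 18
  x44 := (x 19 : ℚ) • (1 : LocalAlg) + (x 20 : ℚ) • etaBar + (x 21 : ℚ) • xiBar

/-- The coordinates of an element of `A`. -/
noncomputable def coord (a : AlgA) : Fin 22 → ℚ :=
  ![a.x11 0 0, a.x11 0 1, a.x11 0 2, a.x11 1 0, a.x11 1 1, a.x11 1 2, a.x11 2 0, a.x11 2 1,
    a.x11 2 2, a.x14 0 0, a.x14 1 0, a.x14 2 0, a.x22, a.x24, a.x33, a.x41 0 0, a.x41 0 1,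
    a.x41 0 2, a.x42, localAug a.x44, localEta a.x44, localXi a.x44]

theorem coord_ofCoord (x : ℕ → ℤ) : coord (ofCoord x) = fun i : Fin 22 => (x i : ℚ) := by
  funext i
  fin_cases i <;> simp [coord, ofCoord, localAug_eta, localAug_xi]

theorem coord_injective : Function.Injective coord := by
  intro a b h
  have hi := fun i => congrFun h i
  simp only [coord, Fin.forall_fin_succ] at hi
  simp at hi
  ext1
  case x11 => ext i j; fin_cases i <;> fin_cases j <;> simp [hi]
  case x14 => ext i j; fin_cases i <;> fin_cases j <;> simp [hi]
  case x41 => ext i j; fin_cases i; fin_cases j <;> simp [hi]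
  case x44 => rw [local_eq_coordinates a.x44, local_eq_coordinates b.x44]; simp [hi]
  all_goals simp [hi]

theorem ofCoord_congr {x y : ℕ → ℤ} (h : ∀ i < 22, x i = y i) : ofCoord x = ofCoord y := by
  refine coord_injective ?_
  rw [coord_ofCoord, coord_ofCoord]
  funext i
  rw [h i i.2]

/-- The coordinates, as a linear map. -/
noncomputable def coordLinear : AlgA →ₗ[ℚ] (Fin 22 → ℚ) where
  toFun := coord
  map_add' a b := by
    funext i
    fin_cases i <;> simp [coord]
  map_smul' r a := by
    funext i
    fin_cases i <;> simp [coord]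

theorem ofCoord_add (x y : ℕ → ℤ) : ofCoord x + ofCoord y = ofCoord (fun i => x i + y i) := by
  refine coord_injective ?_
  change coordLinear _ = _
  rw [map_add]
  change coord _ + coord _ = _
  rw [coord_ofCoord, coord_ofCoord, coord_ofCoord]
  funext i
  simp

theorem nsmul_ofCoord (n : ℕ) (x : ℕ → ℤ) : n • ofCoord x = ofCoord (fun i => n * x i) := by
  refine coord_injective ?_
  change coordLinear _ = _
  rw [map_nsmul]
  change n • coord _ = _
  rw [coord_ofCoord, coord_ofCoord]
  funext i
  simp

theorem local_mul_form (a b c a' b' c' : ℚ) :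
    (a • (1 : LocalAlg) + b • etaBar + c • xiBar) * (a' • 1 + b' • etaBar + c' • xiBar) =
      (a * a') • 1 + (a * b' + b * a') • etaBar + (a * c' + c * a') • xiBar := by
  simp only [add_mul, mul_add, smul_mul_smul_comm, one_mul, mul_one, eta_mul_eta, eta_mul_xi,
    xi_mul_eta, xi_mul_xi, smul_zero]
  module

theorem ofCoord_mul (x y : ℕ → ℤ) : ofCoord x * ofCoord y = ofCoord (mulCoord x y) := by
  have haug : ∀ z, localAug (ofCoord z).x44 = z 19 := fun z => by
    simp [ofCoord, localAug_eta, localAug_xi]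
  ext1
  case x11 =>
    ext i j
    rw [AlgA.mul_x11, Matrix.mul_apply, Fin.sum_univ_three]
    fin_cases i <;> fin_cases j <;> simp [ofCoord] <;> norm_cast
  case x14 =>
    ext i j
    rw [AlgA.mul_x14, haug, Matrix.add_apply, Matrix.mul_apply, Fin.sum_univ_three]
    fin_cases i <;> fin_cases j <;> simp [ofCoord] <;> norm_cast
  case x41 =>
    ext i j
    rw [AlgA.mul_x41, haug, Matrix.add_apply, Matrix.mul_apply, Fin.sum_univ_three]
    fin_cases i; fin_cases j <;> simp [ofCoord] <;> norm_cast
  case x22 => simp [ofCoord]; norm_cast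
  case x24 => rw [AlgA.mul_x24, haug]; simp [ofCoord]; norm_cast
  case x33 => simp [ofCoord]; norm_cast
  case x42 => rw [AlgA.mul_x42, haug]; simp [ofCoord]; norm_cast
  case x44 =>
    have h : ((ofCoord x).x41 * (ofCoord y).x14) 0 0 =
        (x 15 : ℚ) * y 9 + x 16 * y 10 + x 17 * y 11 := by
      simp [ofCoord, Matrix.mul_apply, Fin.sum_univ_three]
    have h19 : mulCoord x y 19 = x 19 * y 19 := rfl
    have h20 : mulCoord x y 20 = x 15 * y 9 + x 16 * y 10 + x 17 * y 11 - 12 * (x 18 * y 13) +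
      x 19 * y 20 + x 20 * y 19 := rfl
    have h21 : mulCoord x y 21 = x 18 * y 13 + x 19 * y 21 + x 21 * y 19 := rfl
    rw [AlgA.mul_x44, h]
    simp only [ofCoord]
    rw [local_mul_form, h19, h20, h21]
    push_cast
    module

/-! ### The isomorphism -/

/-- The function on subgroups that gives the homomorphism to `A`. -/
noncomputable def subgroupValue (K : Subgroup (Perm (Fin 3) × Perm (Fin 3))) : AlgA :=
  (1 / 36 : ℚ) • ofCoord (row (subgroupWeight K))

theorem subgroupValue_conjBy (p : Perm (Fin 3) × Perm (Fin 3))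
    (K : Subgroup (Perm (Fin 3) × Perm (Fin 3))) :
    subgroupValue (conjBy p K) = subgroupValue K := by
  rw [subgroupValue, subgroupWeight_conjBy, subgroupValue]

theorem sum_overlap_of_hasCode {r s : ℕ} (hr : r ∈ codes) (hs : s ∈ codes)
    {K L : Subgroup (Perm (Fin 3) × Perm (Fin 3))} (hK : HasCode r K) (hL : HasCode s L) :
    ∑ g, overlap (conjBy (1, g) K) L • subgroupValue (relComp (conjBy (1, g) K) L) =
      Fintype.card (Perm (Fin 3)) ^ 2 • (subgroupValue K * subgroupValue L) := by
  have h1 : ∑ g, overlap (conjBy (1, g) K) L • ofCoord (row (subgroupWeight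
      (relComp (conjBy (1, g) K) L))) =
      ofCoord (row (subgroupWeight K)) * ofCoord (row (subgroupWeight L)) := by
    rw [ofCoord_mul, sum_perm, sumSix_congr (g := fun g => overlapIdx r s g •
      ofCoord (row (compWeight r s g))) fun g => by
        rw [overlap_eq g hK hL, subgroupWeight_relComp g hK hL]]
    simp only [sumSix, nsmul_ofCoord, ofCoord_add]
    refine ofCoord_congr fun i hi => ?_
    have h := table_mul
    simp only [List.all_eq_true, List.mem_range, beq_iff_eq] at h
    rw [hK.subgroupWeight_eq, hL.subgroupWeight_eq]
    exact h r hr s hs i hi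
  have h2 : Fintype.card (Perm (Fin 3)) = 6 := by
    rw [Fintype.card_perm, Fintype.card_fin]
    rfl
  simp only [subgroupValue, smul_mul_smul_comm, ← h1, h2]
  simp only [← Nat.cast_smul_eq_nsmul ℚ, smul_smul, Finset.smul_sum]
  refine Finset.sum_congr rfl fun g _ => ?_
  congr 1
  push_cast
  ring

/-- Both sides are invariant under conjugating `K` and `L` independently, so the check on
representatives suffices. -/
theorem sum_overlap (K L : Subgroup (Perm (Fin 3) × Perm (Fin 3))) :
    ∑ g, overlap (conjBy (1, g) K) L • subgroupValue (relComp (conjBy (1, g) K) L) =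
      Fintype.card (Perm (Fin 3)) ^ 2 • (subgroupValue K * subgroupValue L) := by
  obtain ⟨p, r, hr, hK⟩ := exists_hasCode K
  obtain ⟨q, s, hs, hL⟩ := exists_hasCode L
  rw [← sum_overlap_conjBy subgroupValue_conjBy p q, sum_overlap_of_hasCode hr hs hK hL,
    subgroupValue_conjBy, subgroupValue_conjBy]

/-- The binary digits `1` stand at the multiples `7 a` with `a < 6`, the numbers `6 a + a` of the
diagonal pairs. -/
theorem hasCode_diagonal : HasCode 34630287489
    (MonoidHom.prod (MonoidHom.id (Perm (Fin 3))) (MonoidHom.id (Perm (Fin 3)))).range := by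
  intro k hk
  have h : ∀ a b : Fin 6, perm a = perm b ↔ Nat.testBit 34630287489 (6 * a + b) = true := by
    decide +kernel
  have h' := h ⟨k / 6, by omega⟩ ⟨k % 6, by omega⟩
  rw [Nat.div_add_mod] at h'
  rw [← h', MonoidHom.mem_range]
  simp [pair, Prod.ext_iff]

theorem stabSum_regular_eq_one : stabSum subgroupValue (regular (Perm (Fin 3))) = 1 := by
  -- The identity, two 3-cycles and three transpositions contribute `5 + 2 * 6 + 3 * 1`. The row of
  -- this weight is six times the unit of `A`, and `6 * 6 / 36 = 1`.
  have hw : totalWeight 34630287489 = 20 := by decide +kernel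
  have hr : ∀ i < 22, row 20 i = 6 * [1, 0, 0, 0, 1, 0, 0, 0, 1, 0, 0, 0, 1, 0, 1, 0, 0, 0, 0, 1,
    0, 0].getD i 0 := by decide +kernel
  have h2 : Fintype.card (Perm (Fin 3)) = 6 := by
    rw [Fintype.card_perm, Fintype.card_fin]
    rfl
  rw [stabSum_regular subgroupValue_conjBy, subgroupValue, hasCode_diagonal.subgroupWeight_eq, hw,
    ofCoord_congr hr, h2]
  have h6 := nsmul_ofCoord 6 fun i => [1, 0, 0, 0, 1, 0, 0, 0, 1, 0, 0, 0, 1, 0, 1, 0, 0, 0, 0, 1,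
    0, 0].getD i 0
  rw [← Nat.cast_smul_eq_nsmul ℚ] at h6 ⊢
  push_cast at h6 ⊢
  rw [← h6, smul_smul, smul_smul]
  norm_num
  refine coord_injective ?_
  rw [coord_ofCoord]
  funext i
  fin_cases i <;> simp [coord]

/-- The homomorphism from the double Burnside algebra of `S₃` to `A`. -/
noncomputable def burnsideToA : DoubleBurnside ℚ (Perm (Fin 3)) →ₐ[ℚ] AlgA :=
  stabHom subgroupValue stabSum_regular_eq_one (stabSum_tensor sum_overlap)

theorem perm_invIdx (a : Fin 6) : perm (invIdx a) = (perm a)⁻¹ := by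
  revert a
  decide +kernel

theorem invIdx_lt (a : Fin 6) : invIdx a < 6 := by
  revert a
  decide +kernel

theorem pair_invPair {k : ℕ} (hk : k < 36) : pair (invPair k) = (pair k)⁻¹ := by
  have h1 := perm_invIdx ⟨k / 6, by omega⟩
  have h2 := perm_invIdx ⟨k % 6, by omega⟩
  have h3 := pair_add ⟨_, invIdx_lt ⟨k / 6, by omega⟩⟩ ⟨_, invIdx_lt ⟨k % 6, by omega⟩⟩
  exact h3.trans (Prod.ext h1 h2)

theorem pair_injOn {k l : ℕ} (hk : k < 36) (hl : l < 36) (h : pair k = pair l) : k = l := by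
  have h1 := perm_bijective.1 (a₁ := ⟨k / 6, by omega⟩) (a₂ := ⟨l / 6, by omega⟩)
    (congrArg Prod.fst h)
  have h2 := perm_bijective.1 (a₁ := ⟨k % 6, by omega⟩) (a₂ := ⟨l % 6, by omega⟩)
    (congrArg Prod.snd h)
  simp only [Fin.mk.injEq] at h1 h2
  omega

theorem exists_subgroup {r : ℕ} (hr : r ∈ codes) : ∃ K, HasCode r K := by
  have h := codes_closed
  simp only [List.all_eq_true, Bool.and_eq_true, List.mem_range, Bool.or_eq_true,
    Bool.not_eq_true'] at h
  obtain ⟨h1, h2⟩ := h r hr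
  refine ⟨
    { carrier := {x | ∃ k < 36, r.testBit k = true ∧ pair k = x}
      mul_mem' := ?_
      one_mem' := ⟨0, by omega, h1, rfl⟩
      inv_mem' := ?_ }, fun k hk => ⟨?_, fun hb => ⟨k, hk, hb, rfl⟩⟩⟩
  · rintro _ _ ⟨k, hk, hkb, rfl⟩ ⟨l, hl, hlb, rfl⟩
    refine ⟨mulPair k l, ?_, ?_, pair_mulPair hk hl⟩
    · have e1 := mulIdx_lt ⟨k / 6, by omega⟩ ⟨l / 6, by omega⟩
      have e2 := mulIdx_lt ⟨k % 6, by omega⟩ ⟨l % 6, by omega⟩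
      simp only [mulPair] at *
      omega
    · exact (((h2 k hk).resolve_left (by simp [hkb])).2 l hl).resolve_left (by simp [hlb])
  · rintro _ ⟨k, hk, hkb, rfl⟩
    refine ⟨invPair k, ?_, ((h2 k hk).resolve_left (by simp [hkb])).1, pair_invPair hk⟩
    have e1 := invIdx_lt ⟨k / 6, by omega⟩
    have e2 := invIdx_lt ⟨k % 6, by omega⟩
    simp only [invPair] at *
    omega
  · rintro ⟨l, hl, hlb, hlk⟩
    rwa [pair_injOn hk hl hlk.symm]

theorem code_mem (i : Fin 22) : code i ∈ codes := by
  revert i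
  decide +kernel

/-- The subgroup with the `i`-th code. -/
noncomputable def rep (i : Fin 22) : Subgroup (Perm (Fin 3) × Perm (Fin 3)) :=
  (exists_subgroup (code_mem i)).choose

theorem hasCode_rep (i : Fin 22) : HasCode (code i) (rep i) :=
  (exists_subgroup (code_mem i)).choose_spec

/-- The linear combinations of the chosen transitive bisets. -/
noncomputable def repLinear : (Fin 22 → ℚ) →ₗ[ℚ] DoubleBurnside ℚ (Perm (Fin 3)) :=
  Fintype.linearCombination ℚ fun i => ofBiset (coset (rep i))

/-- Every subgroup is conjugate to one with a listed code, and the code determines the subgroup, so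
`span_coset` applies to the chosen 22 bisets. -/
theorem repLinear_surjective : Function.Surjective repLinear := by
  rw [← LinearMap.range_eq_top, repLinear, Fintype.range_linearCombination, eq_top_iff,
    ← span_coset (fun K => ∃ r ∈ codes, HasCode r K) exists_hasCode]
  refine Submodule.span_mono ?_
  rintro _ ⟨K, ⟨r, hr, hK⟩, rfl⟩
  obtain ⟨n, hn, rfl⟩ := List.getElem_of_mem hr
  refine ⟨⟨n, hn⟩, ?_⟩
  have h : code ⟨n, hn⟩ = codes[n] := (List.getElem_eq_getD 0).symm
  rw [hK.unique (h ▸ hasCode_rep ⟨n, hn⟩)]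

theorem coord_burnsideToA_repLinear (c : Fin 22 → ℚ) (j : Fin 22) :
    coordLinear (burnsideToA (repLinear c)) j =
      ∑ i, (c i * ((rep i).index / 36)) * row (totalWeight (code i)) j := by
  rw [repLinear, Fintype.linearCombination_apply, map_sum, map_sum, Finset.sum_apply]
  refine Finset.sum_congr rfl fun i _ => ?_
  rw [map_smul, map_smul, burnsideToA, stabHom_ofBiset, stabSum_coset subgroupValue_conjBy,
    subgroupValue, (hasCode_rep i).subgroupWeight_eq, map_nsmul, map_smul]
  change c i • ((rep i).index • ((1 / 36 : ℚ) • coord _)) j = _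
  rw [coord_ofCoord]
  simp only [Pi.smul_apply, smul_eq_mul, nsmul_eq_mul]
  ring

/-- The images of the chosen bisets are nonzero multiples of the rows of an invertible matrix.
Injectivity suffices, since both sides have dimension 22. -/
theorem coord_comp_bijective :
    Function.Bijective (coordLinear ∘ₗ burnsideToA.toLinearMap ∘ₗ repLinear) := by
  have hinj : Function.Injective (coordLinear ∘ₗ burnsideToA.toLinearMap ∘ₗ repLinear) := by
    rw [injective_iff_map_eq_zero]
    intro c hc
    have h : ∀ j : Fin 22, ∑ i, (c i * ((rep i).index / 36)) * row (totalWeight (code i)) j = 0 :=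
      fun j => by rw [← coord_burnsideToA_repLinear]; exact congrFun hc j
    funext k
    -- Pairing the vanishing combination of rows with column `k` of `invTable` isolates the
    -- coefficient `c k`.
    have h3 : ∑ i, (c i * ((rep i).index / 36)) * (if i = k then 72 else 0) = 0 := by
      calc _ = ∑ i, (c i * ((rep i).index / 36)) * ∑ j : Fin 22,
            (row (totalWeight (code i)) j : ℚ) * ((invTable.getD j []).getD k 0 : ℤ) := by
            refine Finset.sum_congr rfl fun i _ => ?_
            have h4 := congrArg (Int.cast : ℤ → ℚ) (table_mul_invTable i k)
            push_cast at h4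
            rw [h4]
        _ = ∑ j : Fin 22, (∑ i, (c i * ((rep i).index / 36)) * row (totalWeight (code i)) j) *
              ((invTable.getD j []).getD k 0 : ℤ) := by
            simp only [Finset.mul_sum, Finset.sum_mul, mul_assoc]
            exact Finset.sum_comm
        _ = 0 := by simp only [h, zero_mul, Finset.sum_const_zero]
    rw [Finset.sum_eq_single k (fun i _ hi => by rw [if_neg hi, mul_zero]) (by simp),
      if_pos rfl] at h3
    have hidx : ((rep k).index : ℚ) ≠ 0 := by
      exact_mod_cast Subgroup.FiniteIndex.index_ne_zero
    simpa [hidx] using h3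
  exact ⟨hinj, LinearMap.injective_iff_surjective.1 hinj⟩

/-- As `repLinear` is onto, injectivity of the composite passes to `burnsideToA`; as the coordinates
are injective, so does surjectivity. Linear independence of the transitive bisets is not needed
beforehand. -/
theorem burnsideToA_bijective : Function.Bijective burnsideToA := by
  obtain ⟨h1, h2⟩ := coord_comp_bijective
  constructor
  · intro x y h
    obtain ⟨c, rfl⟩ := repLinear_surjective x
    obtain ⟨d, rfl⟩ := repLinear_surjective y
    exact congrArg repLinear (h1 (congrArg coordLinear h))
  · intro a
    obtain ⟨c, hc⟩ := h2 (coordLinear a)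
    exact ⟨repLinear c, coord_injective hc⟩

/-- The double Burnside algebra of `S₃` is isomorphic to `A`. -/
noncomputable def burnsideEquivA : DoubleBurnside ℚ (Perm (Fin 3)) ≃ₐ[ℚ] AlgA :=
  AlgEquiv.ofBijective burnsideToA burnsideToA_bijective

end SymThree

end SymmetricThree

theorem proposition4p6 :
    (∃ φ : CornerA ≃ₐ[ℚ] Psi.PathQuot,
      φ CornerA.a11 = Psi.toQuot (PathAlgebra.vertex ℚ Psi.v1) ∧
      φ CornerA.a22 = Psi.toQuot (PathAlgebra.vertex ℚ Psi.v2) ∧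
      φ CornerA.a33 = Psi.toQuot (PathAlgebra.vertex ℚ Psi.v3) ∧
      φ CornerA.a44 = Psi.toQuot (PathAlgebra.vertex ℚ Psi.v4) ∧
      φ CornerA.a41 = Psi.toQuot Psi.rho ∧
      φ CornerA.a14 = Psi.toQuot Psi.pi ∧
      φ CornerA.a42 = Psi.toQuot Psi.theta ∧
      φ CornerA.a24 = Psi.toQuot Psi.sigma) ∧
    Nonempty (AlgA ≃ₐ[ℚ] DoubleBurnside ℚ (Equiv.Perm (Fin 3))) ∧
    IsMoritaEquivalent ℚ AlgA Psi.PathQuot ∧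
    IsMoritaEquivalent ℚ (DoubleBurnside ℚ (Equiv.Perm (Fin 3))) Psi.PathQuot :=
  ⟨⟨CornerA.equivPathQuot, CornerA.equivPathQuot_ofVertex .v1,
      CornerA.equivPathQuot_ofVertex .v2, CornerA.equivPathQuot_ofVertex .v3,
      CornerA.equivPathQuot_ofVertex .v4, CornerA.equivPathQuot_ofArrow .rho,
      CornerA.equivPathQuot_ofArrow .pi, CornerA.equivPathQuot_ofArrow .theta,
      CornerA.equivPathQuot_ofArrow .sigma⟩,
    ⟨SymThree.burnsideEquivA.symm⟩, isMoritaEquivalent_of_algEquiv_algA AlgEquiv.refl,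
    isMoritaEquivalent_of_algEquiv_algA SymThree.burnsideEquivA⟩
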